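/- Let $p$ be a prime and let $K$ be a number field that contains no CM subfield. Put $\mathcal{O}_{K,p} = \mathbb{Z}_p \otimes \mathcal{O}_K$ and $\mathcal{W} = \operatorname{Spf} \mathbb{Z}_p[[\mathcal{O}_{K,p}^\times]]$, the character space of $\mathcal{O}_{K,p}^\times$. Its points (called weights) are the continuous homomorphisms $\kappa : \mathcal{O}_{K,p}^\times \to E^\times$ with $E \subset \overline{\mathbb{Q}}_p$ a finite extension of $\mathbb{Q}_p$; they form a group under multiplication. Let $U$ be an open compact subgroup of the group of finite ideles of $K$ away from $p$, let $K_\infty^\circ$ be the identity component of $(K \otimes \mathbb{R})^\times$, let $\Gamma(U) = K^\times \cap (U \cdot \mathcal{O}_{K,p}^\times \cdot K_\infty^\circ)$, and let $\mathcal{W}(U)$ be the character space of $\mathcal{O}_{K,p}^\times/\overline{\Gamma(U)}$; its points are the weights that are trivial on $\overline{\Gamma(U)}$. A weight is algebraic on a subset $V \subseteq \mathcal{O}_{K,p}^\times$ if there are integers $n_\sigma$, indexed by the embeddings $\sigma : K \to \overline{\mathbb{Q}}_p$, such that $\kappa(x) = \prod_\sigma \sigma(x)^{n_\sigma}$ for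 all $x \in V$. It is locally algebraic if it is algebraic on some neighbourhood of $1$; then $c(\kappa)$ denotes the least integer $r \ge 0$ such that $\kappa$ is algebraic on $\mathcal{O}_{K,p}^\times \cap (1 + p^r \mathcal{O}_{K,p})$. A weight is parallel if it factors through the norm $N_{K/\mathbb{Q}} : \mathcal{O}_{K,p}^\times \to N_{K/\mathbb{Q}}(\mathcal{O}_{K,p}^\times) \subseteq \mathbb{Z}_p^\times$. Let $\mathcal{W}_0 \subseteq \mathcal{W}$ be the closed formal subscheme given by the character space of $N_{K/\mathbb{Q}}(\mathcal{O}_{K,p}^\times)$, that is, by the kernel of $\mathbb{Z}_p[[\mathcal{O}_{K,p}^\times]] \to \mathbb{Z}_p[[N_{K/\mathbb{Q}}(\mathcal{O}_{K,p}^\times)]]$. Dimensions of flat formal $\mathbb{Z}_p$-schemes are relative to $\mathbb{Z}_p$: the dimension of $\operatorname{Spf}(A)$ is the Krull dimension of $A[1/p]$. Then $\mathcal{W}_0$ is flat over $\mathbb{Z}_p$ of dimension $1$, and its points are exactly the parallel weights. Moreover, for every integer $N \ge 0$ there is a finite set $S$ of weights of finite order such that: (a) every locally algebraic weight $\kappa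 \in \mathcal{W}(U)$ with $c(\kappa) \le N$ is of the form $\kappa = \varepsilon \cdot N_{K/\mathbb{Q}}^k$ with $\varepsilon \in S$ and $k \in \mathbb{Z}$; in particular all these weights lie in the finite union $\bigcup_{\varepsilon \in S} \varepsilon \cdot \mathcal{W}_0$ of translates of (the set of points of) $\mathcal{W}_0$; (b) there is a closed formal subscheme $Z$ of $\mathcal{W}$, flat over $\mathbb{Z}_p$ and of dimension $1$, that contains all points of $\bigcup_{\varepsilon \in S} \varepsilon \cdot \mathcal{W}_0$, and hence every locally algebraic weight $\kappa \in \mathcal{W}(U)$ with $c(\kappa) \le N$. -/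

import Mathlib

open NumberField Topology IsDedekindDomain
open scoped TensorProduct RestrictedProduct

noncomputable section

/-! ### Iwasawa algebras, and closed formal subschemes of character spaces -/

section Iwasawa

variable (p : ℕ) [Fact p.Prime]
variable (G : Type*) [CommGroup G] [TopologicalSpace G]

/-- The transition map `ℤ_p[G/V] → ℤ_p[G/W]` for open subgroups `V ≤ W` of `G`. -/
def iwasawaTransition {V W : OpenSubgroup G} (h : V ≤ W) :
    MonoidAlgebra ℤ_[p] (G ⧸ (V : Subgroup G)) →ₐ[ℤ_[p]]
      MonoidAlgebra ℤ_[p] (G ⧸ (W : Subgroup G)) :=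
  MonoidAlgebra.mapDomainAlgHom ℤ_[p] ℤ_[p]
    (QuotientGroup.map (V : Subgroup G) (W : Subgroup G) (MonoidHom.id G) h)

/-- The Iwasawa algebra `ℤ_p⟦G⟧ = lim_V ℤ_p[G/V]`, the limit being over the open subgroups `V`
of `G`, realised as the algebra of compatible families.  The character space `Ĝ` is the formal
scheme `Spf ℤ_p⟦G⟧`. -/
def IwasawaAlgebra : Subalgebra ℤ_[p]
    (∀ V : OpenSubgroup G, MonoidAlgebra ℤ_[p] (G ⧸ (V : Subgroup G))) where
  carrier := {a | ∀ (V W : OpenSubgroup G) (h : V ≤ W), iwasawaTransition p G h (a V) = a W}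
  mul_mem' := by
    intro a b ha hb V W h
    simp only [Pi.mul_apply, map_mul, ha V W h, hb V W h]
  add_mem' := by
    intro a b ha hb V W h
    simp only [Pi.add_apply, map_add, ha V W h, hb V W h]
  algebraMap_mem' := by
    intro r V W h
    simp only [Pi.algebraMap_apply, AlgHom.commutes]

/-- The inverse limit topology on `ℤ_p⟦G⟧`, each `ℤ_p[G/V]` having the topology of coefficientwise
`p`-adic convergence. -/
instance : TopologicalSpace (IwasawaAlgebra p G) :=
  TopologicalSpace.induced
    (fun a (V : OpenSubgroup G) (g : G ⧸ (V : Subgroup G)) => (a.1 V).coeff g) inferInstance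

variable {G}

/-- The canonical character `G → ℤ_p⟦G⟧`, `g ↦ [g]`. -/
def IwasawaAlgebra.of (g : G) : IwasawaAlgebra p G :=
  ⟨fun V => MonoidAlgebra.single (QuotientGroup.mk' (V : Subgroup G) g) 1, by
    intro V W h
    simp only [iwasawaTransition, MonoidAlgebra.mapDomainAlgHom_apply, MonoidAlgebra.mapDomain_single]
    rfl⟩

/-- The push-forward `ℤ_p⟦G⟧ → ℤ_p⟦H⟧` along a continuous homomorphism `f : G → H`. -/
def IwasawaAlgebra.map {H : Type*} [CommGroup H] [TopologicalSpace H]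
    (f : ContinuousMonoidHom G H) : IwasawaAlgebra p G →ₐ[ℤ_[p]] IwasawaAlgebra p H :=
  AlgHom.codRestrict
    (AlgHom.pi fun V : OpenSubgroup H =>
      ((MonoidAlgebra.mapDomainAlgHom ℤ_[p] ℤ_[p]
        (QuotientGroup.map ((V.comap f.toMonoidHom f.continuous_toFun : OpenSubgroup G) :
          Subgroup G) (V : Subgroup H) f.toMonoidHom le_rfl)).comp
        (Pi.evalAlgHom ℤ_[p]
          (fun V : OpenSubgroup G => MonoidAlgebra ℤ_[p] (G ⧸ (V : Subgroup G)))
          (V.comap f.toMonoidHom f.continuous_toFun))).comp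
        (IwasawaAlgebra p G).val)
    (IwasawaAlgebra p H) (by
      rintro ⟨a, ha⟩ V W h
      have key := ha (V.comap f.toMonoidHom f.continuous_toFun)
        (W.comap f.toMonoidHom f.continuous_toFun) (fun x hx => h hx)
      simp only [AlgHom.pi_apply, AlgHom.comp_apply, Pi.evalAlgHom_apply, Subalgebra.coe_val,
        ← key, iwasawaTransition]
      rw [← AlgHom.comp_apply, ← AlgHom.comp_apply, ← MonoidAlgebra.mapDomainAlgHom_comp,
        ← MonoidAlgebra.mapDomainAlgHom_comp]
      congr 2
      ext x
      rfl)

variable (G) in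
/-- Closed formal subschemes `Spf (ℤ_p⟦G⟧/I)` of the affine formal scheme `Ĝ = Spf ℤ_p⟦G⟧`,
given by their ideals `I`. -/
abbrev ClosedFormalSubscheme := Ideal (IwasawaAlgebra p G)

variable {p}

/-- The closed formal subscheme is flat over `ℤ_p`, of dimension `d`.  Dimensions of flat formal
`ℤ_p`-schemes are relative to `ℤ_p`: they are the dimension of the generic fibre
`Spec (ℤ_p⟦G⟧/I)[1/p]`. -/
def ClosedFormalSubscheme.IsFlatOfDim (Z : ClosedFormalSubscheme p G) (d : ℕ) : Prop :=
  Module.Flat ℤ_[p] (IwasawaAlgebra p G ⧸ Z) ∧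
    ringKrullDim (Localization.Away (p : IwasawaAlgebra p G ⧸ Z)) = d

/-- The point `κ` of `Ĝ` lies on the closed formal subscheme `Z`: the continuous ring homomorphism
on `ℤ_p⟦G⟧` that corresponds to the character `κ` kills the ideal of `Z`. -/
def ClosedFormalSubscheme.HasPoint (Z : ClosedFormalSubscheme p G)
    (κ : ContinuousMonoidHom G (PadicAlgCl p)ˣ) : Prop :=
  ∃ φ : IwasawaAlgebra p G →+* PadicAlgCl p, Continuous φ ∧
    (∀ g, φ (IwasawaAlgebra.of p g) = κ g) ∧ ∀ a ∈ Z, φ a = 0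

end Iwasawa

/-! ### The group `𝒪_{K,p}ˣ` and `p`-adic weights -/

section Weights

variable (p : ℕ) [Fact p.Prime] (K : Type*) [Field K] [NumberField K]

/-- `𝒪_{K,p} = ℤ_p ⊗ 𝒪_K`. -/
def OKp : Type _ := ℤ_[p] ⊗[ℤ] 𝓞 K

instance : CommRing (OKp p K) := inferInstanceAs (CommRing (ℤ_[p] ⊗[ℤ] 𝓞 K))

instance : Algebra ℤ_[p] (OKp p K) := inferInstanceAs (Algebra ℤ_[p] (ℤ_[p] ⊗[ℤ] 𝓞 K))

instance : Module.Finite ℤ_[p] (OKp p K) :=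
  inferInstanceAs (Module.Finite ℤ_[p] (ℤ_[p] ⊗[ℤ] 𝓞 K))

instance : Module.Free ℤ_[p] (OKp p K) :=
  inferInstanceAs (Module.Free ℤ_[p] (ℤ_[p] ⊗[ℤ] 𝓞 K))

/-- The `p`-adic topology: that of a finite free `ℤ_p`-module. -/
instance : TopologicalSpace (OKp p K) := moduleTopology ℤ_[p] (OKp p K)

instance : IsModuleTopology ℤ_[p] (OKp p K) := ⟨rfl⟩

instance : IsTopologicalRing (OKp p K) := IsModuleTopology.isTopologicalRing ℤ_[p] (OKp p K)

/-- A `p`-adic weight for `K`, i.e. a point of the character space `𝒲` of `𝒪_{K,p}ˣ`: a continuous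
homomorphism to `Eˣ` for some finite extension `E` of `ℚ_p` (inside a fixed `ℚ̄_p`).  Weights form
a group under multiplication. -/
def PadicWeight : Subgroup (ContinuousMonoidHom (OKp p K)ˣ (PadicAlgCl p)ˣ) where
  carrier := {κ | ∃ E : IntermediateField ℚ_[p] (PadicAlgCl p),
    FiniteDimensional ℚ_[p] E ∧ ∀ x, ((κ x : (PadicAlgCl p)ˣ) : PadicAlgCl p) ∈ E}
  one_mem' := ⟨⊥, inferInstance, fun x => by simp⟩
  mul_mem' := by
    rintro a b ⟨E, hE, ha⟩ ⟨F, hF, hb⟩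
    refine ⟨E ⊔ F, IntermediateField.finiteDimensional_sup E F, fun x => ?_⟩
    rw [ContinuousMonoidHom.mul_apply, Units.val_mul]
    exact mul_mem (le_sup_left (a := E) (b := F) (ha x)) (le_sup_right (a := E) (b := F) (hb x))
  inv_mem' := by
    rintro a ⟨E, hE, ha⟩
    refine ⟨E, hE, fun x => ?_⟩
    have h : (a⁻¹) x = (a x)⁻¹ := rfl
    rw [h, Units.val_inv_eq_inv_val]
    exact inv_mem (ha x)

/-- The points (weights) on a closed formal subscheme of `𝒲`. -/
def weightPoints (Z : ClosedFormalSubscheme p (OKp p K)ˣ) : Set (PadicWeight p K) :=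
  {κ | Z.HasPoint κ.1}

variable {K} in
/-- The ring homomorphism `𝒪_{K,p} → ℚ̄_p` arising from an embedding `σ : K → ℚ̄_p`. -/
def OKp.embed (σ : K →+* PadicAlgCl p) : OKp p K →+* PadicAlgCl p :=
  (Algebra.TensorProduct.productMap
    ((algebraMap ℚ_[p] (PadicAlgCl p)).comp PadicInt.Coe.ringHom).toIntAlgHom
    (σ.comp (algebraMap (𝓞 K) K)).toIntAlgHom : ℤ_[p] ⊗[ℤ] 𝓞 K →ₐ[ℤ] PadicAlgCl p).toRingHom

variable {p K}

/-- `κ` is algebraic on the set `V`: it agrees there with `x ↦ ∏ σ(x)^{n_σ}`, the product being over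
the embeddings `σ : K → ℚ̄_p`, for some integers `n_σ`. -/
def IsAlgebraicOn (κ : PadicWeight p K) (V : Set (OKp p K)ˣ) : Prop :=
  ∃ n : (K →+* PadicAlgCl p) → ℤ, ∀ x ∈ V,
    ((κ.1 x : (PadicAlgCl p)ˣ) : PadicAlgCl p) = ∏ σ, (OKp.embed p σ x) ^ n σ

/-- `κ` is locally algebraic: it is algebraic on some neighbourhood of the identity. -/
def IsLocallyAlgebraic (κ : PadicWeight p K) : Prop :=
  ∃ V ∈ 𝓝 (1 : (OKp p K)ˣ), IsAlgebraicOn κ V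

variable (p K) in
/-- The units that are in `1 + p^r 𝒪_{K,p}` (all units if `r = 0`). -/
def onePlus (r : ℕ) : Set (OKp p K)ˣ :=
  {x | ∃ y : OKp p K, (x : OKp p K) = 1 + (p : OKp p K) ^ r * y}

/-- The conductor exponent `c(κ)` of a locally algebraic weight. -/
def conductorExponent (κ : PadicWeight p K) : ℕ :=
  sInf {r : ℕ | IsAlgebraicOn κ (onePlus p K r)}

variable (p K)

theorem OKp.continuous_norm : Continuous (Algebra.norm ℤ_[p] : OKp p K → ℤ_[p]) := by
  let b := Module.Free.chooseBasis ℤ_[p] (OKp p K)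
  have h : (Algebra.norm ℤ_[p] : OKp p K → ℤ_[p]) =
      fun x => (Algebra.leftMulMatrix b x).det := by
    ext x
    rw [Algebra.norm_eq_matrix_det b]
  rw [h]
  refine Continuous.matrix_det (continuous_matrix fun i j => ?_)
  exact IsModuleTopology.continuous_of_linearMap
    ((Matrix.entryLinearMap ℤ_[p] ℤ_[p] i j) ∘ₗ (Algebra.leftMulMatrix b).toLinearMap)

/-- The norm map `N_{K/ℚ} : 𝒪_{K,p}ˣ → ℤ_pˣ`. -/
def unitsNorm : ContinuousMonoidHom (OKp p K)ˣ ℤ_[p]ˣ where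
  toMonoidHom := Units.map (Algebra.norm ℤ_[p])
  continuous_toFun := Continuous.units_map _ (OKp.continuous_norm p K)

/-- The image `N_{K/ℚ}(𝒪_{K,p}ˣ) ⊆ ℤ_pˣ`. -/
abbrev NormImage : Subgroup ℤ_[p]ˣ := (unitsNorm p K).toMonoidHom.range

/-- The norm map, onto its image. -/
def normOntoImage : ContinuousMonoidHom (OKp p K)ˣ (NormImage p K) where
  toMonoidHom := (unitsNorm p K).toMonoidHom.rangeRestrict
  continuous_toFun := (unitsNorm p K).continuous_toFun.subtype_mk _

/-- The inclusion `ℤ_p → ℚ̄_p`. -/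
def padicIntToAlgCl : ℤ_[p] →+* PadicAlgCl p :=
  (algebraMap ℚ_[p] (PadicAlgCl p)).comp PadicInt.Coe.ringHom

/-- The norm, as a `p`-adic weight. -/
def normWeight : PadicWeight p K :=
  ⟨{ toMonoidHom :=
        (Units.map (padicIntToAlgCl p).toMonoidHom).comp (unitsNorm p K).toMonoidHom
     continuous_toFun := by
        refine (Continuous.units_map (padicIntToAlgCl p).toMonoidHom ?_).comp
          (unitsNorm p K).continuous_toFun
        exact (continuous_algebraMap ℚ_[p] (PadicAlgCl p)).comp continuous_subtype_val },
   ⊥, inferInstance, fun x => IntermediateField.algebraMap_mem _ _⟩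

variable {p K} in
/-- `κ` is parallel: it factors through the norm map (onto its image). -/
def IsParallel (κ : PadicWeight p K) : Prop :=
  ∃ χ : ContinuousMonoidHom (NormImage p K) (PadicAlgCl p)ˣ,
    ∀ x, κ.1 x = χ (normOntoImage p K x)

/-- The closed formal subscheme `𝒲₀` of `𝒲` parametrising parallel weights: the character space of
`N_{K/ℚ}(𝒪_{K,p}ˣ)`, embedded in `𝒲` by pull-back along the norm. -/
def parallelSubscheme : ClosedFormalSubscheme p (OKp p K)ˣ :=
  RingHom.ker (IwasawaAlgebra.map p (normOntoImage p K))

end Weights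

/-! ### Tame levels and the space `𝒲(U)` -/

section Level

variable (p : ℕ) [Fact p.Prime] (K : Type*) [Field K] [NumberField K]

/-- The finite adeles of `K` away from `p`. -/
abbrev AdelesAway : Type _ :=
  Πʳ v : {v : HeightOneSpectrum (𝓞 K) // (p : 𝓞 K) ∉ v.asIdeal},
    [v.1.adicCompletion K, v.1.adicCompletionIntegers K]

/-- The diagonal embedding of `K` into the finite adeles away from `p`. -/
def AdelesAway.diag : K →+* AdelesAway p K where
  toFun k := ⟨fun v => (k : v.1.adicCompletion K),
    Filter.Tendsto.eventually Subtype.val_injective.tendsto_cofinite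
      (algebraMap K (FiniteAdeleRing (𝓞 K) K) k).2⟩
  map_one' := Subtype.ext <| funext fun _ => HeightOneSpectrum.adicCompletion.coe_one ..
  map_mul' _ _ := Subtype.ext <| funext fun _ => HeightOneSpectrum.adicCompletion.coe_mul ..
  map_zero' := Subtype.ext <| funext fun _ => HeightOneSpectrum.adicCompletion.coe_zero ..
  map_add' _ _ := Subtype.ext <| funext fun _ => HeightOneSpectrum.adicCompletion.coe_add ..

/-- The identity component of `(K ⊗ ℝ)ˣ`, with `K ⊗ ℝ = ℝ^{r₁} × ℂ^{r₂}`. -/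
def infIdentityComponent : Subgroup (mixedEmbedding.mixedSpace K)ˣ :=
  Subgroup.connectedComponentOfOne (mixedEmbedding.mixedSpace K)ˣ

/-- The map from `𝒪_{K,p}` to `K_p = ℚ_p ⊗ K`. -/
def OKp.toKp : OKp p K →+* ℚ_[p] ⊗[ℚ] K :=
  (Algebra.TensorProduct.productMap
    ((Algebra.TensorProduct.includeLeftRingHom : ℚ_[p] →+* ℚ_[p] ⊗[ℚ] K).comp
      PadicInt.Coe.ringHom).toIntAlgHom
    (((Algebra.TensorProduct.includeRight : K →ₐ[ℚ] ℚ_[p] ⊗[ℚ] K) : K →+* ℚ_[p] ⊗[ℚ] K).comp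
      (algebraMap (𝓞 K) K)).toIntAlgHom :
    ℤ_[p] ⊗[ℤ] 𝓞 K →ₐ[ℤ] ℚ_[p] ⊗[ℚ] K).toRingHom

variable {p K}

/-- `Γ(U) = Kˣ ∩ (U · 𝒪_{K,p}ˣ · K_∞°)`, as a subgroup of `𝒪_{K,p}ˣ`: the elements whose image in
`K_pˣ` comes from an element of `Kˣ` that lies in `U` and in the identity component at infinity. -/
def gammaLevel (U : Subgroup (AdelesAway p K)ˣ) : Subgroup (OKp p K)ˣ :=
  ((U.comap (Units.map (AdelesAway.diag p K).toMonoidHom) ⊓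
      (infIdentityComponent K).comap (Units.map (mixedEmbedding K).toMonoidHom)).map
    (Units.map
      ((Algebra.TensorProduct.includeRight : K →ₐ[ℚ] ℚ_[p] ⊗[ℚ] K) : K →* ℚ_[p] ⊗[ℚ] K))).comap
    (Units.map (OKp.toKp p K).toMonoidHom)

/-- The points of `𝒲(U)`, the character space of `𝒪_{K,p}ˣ` modulo the closure of `Γ(U)`: the weights
that are trivial on that closure. -/
def weightsOfLevel (U : Subgroup (AdelesAway p K)ˣ) : Set (PadicWeight p K) :=
  {κ | ∀ x ∈ (gammaLevel U).topologicalClosure, κ.1 x = 1}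

end Level

end

/-!
Let `κ` be a locally algebraic weight of level `U` and conductor at most `N`, given by
`x ↦ ∏ σ(x)^{n_σ}` on `1 + p^N 𝒪_{K,p}`.

*The exponents are equal.*  A suitable power of any unit `u` of `𝒪_K` lies both in `Γ(U)` and in
`1 + p^N 𝒪_{K,p}` (`exists_pow_mem_gammaLevel`), so `∏ σ(u)^{n_σ}` is a root of unity.  Transport
this relation to complex embeddings.  By Dirichlet's unit theorem, `n_φ + n_{φ̄}` does not depend on
`φ`, for any choice of complex conjugation on the normal closure of `K`.  Subtracting a constant
from `n`, one gets a function on the embeddings that is odd under every complex conjugation.  It is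
therefore invariant under a normal subgroup of the Galois group that contains all quotients of two
complex conjugations.  On the fixed field of this subgroup complex conjugation is well defined, and
if the function were nonzero at some embedding, the part of `K` mapped into that fixed field would
be a CM field (`NumberField.eq_zero_of_forall_conj_neg`).  So if `K` has no CM subfield, all `n_σ`
are equal (`NumberField.eq_of_forall_units_prod_pow_eq_one`).

*Finitely many translates.*  If all `n_σ` are equal to `k`, then `κ` agrees with `N_{K/ℚ}^k` on
`1 + p^N 𝒪_{K,p}`, because the norm is the product of the embeddings (`OKp.padicIntToAlgCl_norm`).
The quotient `ε` is a character of the finite group `𝒪_{K,p}ˣ / (1 + p^N 𝒪_{K,p})`; these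
characters form the finite set `S`.

*Geometry.*  Both `𝒲₀` and `Z` are the kernels of push-forward along a continuous homomorphism
`f : 𝒪_{K,p}ˣ → Q` of compact groups: for `𝒲₀` the norm onto its image, for `Z` the norm together
with the reduction to `𝒪_{K,p}ˣ / (1 + p^N 𝒪_{K,p})`.  A power `g` of `1 + p²` has image in `Q` that
topologically generates an open subgroup, so `ℤ_p⟦Q⟧`, and with it the image of
`ℤ_p⟦𝒪_{K,p}ˣ⟧`, is finite over `ℤ_p⟦X⟧`, where `1 + X` acts as `[g]`.  This bounds the dimension
of the generic fibre by `1`; it is not `0` because the powers of the norm are infinitely many points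
(`IwasawaAlgebra.isFlatOfDim_one_ker_map`).  Conversely a character of `Q` with values in a finite
extension of `ℚ_p` extends to `ℤ_p⟦Q⟧` as a limit of Riemann sums
(`IwasawaAlgebra.hasPoint_ker_map`), which gives the points.
-/

noncomputable section

/-! ### The topological ring `ℤ_p⟦G⟧` -/

namespace IwasawaAlgebra

open Filter

variable {p : ℕ} [Fact p.Prime] {G : Type*} [CommGroup G] [TopologicalSpace G]

theorem quotient_finite [IsTopologicalGroup G] [CompactSpace G] (V : OpenSubgroup G) :
    Finite (G ⧸ (V : Subgroup G)) :=
  (V : Subgroup G).quotient_finite_of_isOpen V.isOpen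

theorem continuous_coeff (V : OpenSubgroup G) (q : G ⧸ (V : Subgroup G)) :
    Continuous fun a : IwasawaAlgebra p G => (a.1 V).coeff q :=
  (continuous_apply q).comp ((continuous_apply V).comp (continuous_induced_dom
    (f := fun (a : IwasawaAlgebra p G) (V : OpenSubgroup G) (g : G ⧸ (V : Subgroup G)) =>
      (a.1 V).coeff g)))

theorem tendsto_iff {α : Type*} {l : Filter α} {f : α → IwasawaAlgebra p G}
    {a : IwasawaAlgebra p G} :
    Tendsto f l (𝓝 a) ↔
      ∀ V q, Tendsto (fun x => ((f x).1 V).coeff q) l (𝓝 ((a.1 V).coeff q)) := by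
  rw [nhds_induced, tendsto_comap_iff, tendsto_pi_nhds]
  simp only [tendsto_pi_nhds]
  rfl

theorem continuous_iff {X : Type*} [TopologicalSpace X] {f : X → IwasawaAlgebra p G} :
    Continuous f ↔ ∀ V q, Continuous fun x => ((f x).1 V).coeff q := by
  simp only [continuous_iff_continuousAt, ContinuousAt, tendsto_iff]
  exact ⟨fun h V q x => h x V q, fun h x V q => h V q x⟩

instance : T2Space (IwasawaAlgebra p G) := by
  refine T2Space.of_injective_continuous
    (f := fun a (V : OpenSubgroup G) (g : G ⧸ (V : Subgroup G)) => (a.1 V).coeff g) ?_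
    continuous_induced_dom
  intro a b h
  refine Subtype.ext (funext fun V => MonoidAlgebra.ext (Finsupp.ext fun q => ?_))
  exact congrFun (congrFun h V) q

theorem component_of (V : OpenSubgroup G) (g : G) :
    (of p g).1 V = MonoidAlgebra.single (QuotientGroup.mk g) 1 := rfl

theorem of_mul (g h : G) : of p (g * h) = of p g * of p h := by
  refine Subtype.ext (funext fun V => ?_)
  change (of p (g * h)).1 V = (of p g).1 V * (of p h).1 V
  rw [component_of, component_of, component_of, MonoidAlgebra.single_mul_single, mul_one,
    QuotientGroup.mk_mul]

theorem of_one : of p (1 : G) = 1 := rfl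

theorem of_pow (g : G) (n : ℕ) : of p (g ^ n) = of p g ^ n := by
  induction n with
  | zero => simp [of_one]
  | succ n ih => rw [pow_succ, of_mul, ih, pow_succ]

theorem map_of {H : Type*} [CommGroup H] [TopologicalSpace H] (f : ContinuousMonoidHom G H)
    (g : G) : map p f (of p g) = of p (f g) := by
  refine Subtype.ext (funext fun V => ?_)
  exact MonoidAlgebra.mapDomain_single

theorem continuous_of [IsTopologicalGroup G] : Continuous (of p : G → IwasawaAlgebra p G) := by
  refine continuous_iff.2 fun V q => ?_
  have : DiscreteTopology (G ⧸ (V : Subgroup G)) := QuotientGroup.discreteTopology V.isOpen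
  exact (continuous_of_discreteTopology
    (f := fun r : G ⧸ (V : Subgroup G) => (MonoidAlgebra.single r (1 : ℤ_[p])).coeff q)).comp
    continuous_quotient_mk'

variable (p) in
/-- The ideal of elements whose component in `ℤ_p[G/V]` is divisible by `p ^ n`. -/
def basicIdeal (i : OpenSubgroup G × ℕ) : Ideal (IwasawaAlgebra p G) :=
  (Ideal.span {algebraMap ℤ_[p] _ ((p : ℤ_[p]) ^ i.2)}).comap
    ((Pi.evalAlgHom ℤ_[p] (fun V : OpenSubgroup G =>
      MonoidAlgebra ℤ_[p] (G ⧸ (V : Subgroup G))) i.1).comp (IwasawaAlgebra p G).val)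

theorem mem_basicIdeal {i : OpenSubgroup G × ℕ} {a : IwasawaAlgebra p G} :
    a ∈ basicIdeal p i ↔ ∃ y, a.1 i.1 = (p : ℤ_[p]) ^ i.2 • y := by
  rw [basicIdeal, Ideal.mem_comap, Ideal.mem_span_singleton']
  refine exists_congr fun y => ?_
  rw [Algebra.smul_def, mul_comm, eq_comm]
  rfl

/-- The group elements span a dense submodule. -/
theorem eq_top_of_isClosed (M : Submodule ℤ_[p] (IwasawaAlgebra p G))
    (hM : IsClosed (M : Set (IwasawaAlgebra p G))) (h : ∀ g, of p g ∈ M) : M = ⊤ := by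
  refine (Submodule.eq_top_iff').2 fun a => ?_
  -- `a` is the limit of the lifts of its components `a.1 V` to finite sums of group elements
  let s : OpenSubgroup G → IwasawaAlgebra p G := fun V =>
    (a.1 V).coeff.sum fun q c => c • of p q.out
  have hs : ∀ V, s V ∈ M := fun V =>
    Submodule.sum_mem _ fun q _ => M.smul_mem _ (h _)
  have hsV : ∀ V, (s V).1 V = a.1 V := by
    intro V
    conv_rhs => rw [← MonoidAlgebra.sum_coeff_single (a.1 V)]
    change Pi.evalAlgHom ℤ_[p] (fun V : OpenSubgroup G =>
      MonoidAlgebra ℤ_[p] (G ⧸ (V : Subgroup G))) V ((IwasawaAlgebra p G).val (s V)) = _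
    simp only [s, Finsupp.sum, map_sum, map_smul]
    refine Finset.sum_congr rfl fun q _ => ?_
    change (a.1 V).coeff q • (of p q.out).1 V = _
    rw [component_of, MonoidAlgebra.smul_single, smul_eq_mul, mul_one, QuotientGroup.out_eq']
  have hlim : Tendsto s atBot (𝓝 a) := by
    refine tendsto_iff.2 fun W q => tendsto_const_nhds.congr' ?_
    filter_upwards [eventually_le_atBot W] with V hV
    rw [← (s V).2 V W hV, hsV, a.2 V W hV]
  exact hM.mem_of_tendsto hlim (Eventually.of_forall hs)

theorem continuous_linearMap [IsTopologicalGroup G] [CompactSpace G] (V : OpenSubgroup G)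
    (L : MonoidAlgebra ℤ_[p] (G ⧸ (V : Subgroup G)) →ₗ[ℤ_[p]] ℤ_[p]) :
    Continuous fun a : IwasawaAlgebra p G => L (a.1 V) := by
  have := quotient_finite V
  have := Fintype.ofFinite (G ⧸ (V : Subgroup G))
  have h : ∀ x : MonoidAlgebra ℤ_[p] (G ⧸ (V : Subgroup G)),
      L x = ∑ q, x.coeff q * L (MonoidAlgebra.single q 1) := by
    intro x
    conv_lhs => rw [← MonoidAlgebra.sum_coeff_single x, Finsupp.sum_fintype _ _ (by simp), map_sum]
    refine Finset.sum_congr rfl fun q _ => ?_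
    rw [← smul_eq_mul, ← map_smul, MonoidAlgebra.smul_single, smul_eq_mul, mul_one]
  rw [funext fun a : IwasawaAlgebra p G => h (a.1 V)]
  exact continuous_finsetSum _ fun q _ => (continuous_coeff V q).mul continuous_const

variable [IsTopologicalGroup G] [CompactSpace G]

instance : IsTopologicalRing (IwasawaAlgebra p G) where
  continuous_add := by
    refine continuous_iff.2 fun V q => ?_
    exact ((continuous_coeff V q).comp continuous_fst).add
      ((continuous_coeff V q).comp continuous_snd)
  continuous_mul := by
    refine continuous_iff.2 fun V q => ?_
    have := quotient_finite V
    have := Fintype.ofFinite (G ⧸ (V : Subgroup G))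
    have h : ∀ x y : MonoidAlgebra ℤ_[p] (G ⧸ (V : Subgroup G)),
        (x * y).coeff q = ∑ r, x.coeff r * y.coeff (r⁻¹ * q) := by
      intro x y
      rw [MonoidAlgebra.coeff_mul_apply_left, Finsupp.sum_fintype _ _ (by simp)]
    have h' : (fun x : IwasawaAlgebra p G × IwasawaAlgebra p G => ((x.1 * x.2).1 V).coeff q) =
        fun x => ∑ r, (x.1.1 V).coeff r * (x.2.1 V).coeff (r⁻¹ * q) := by
      funext x
      exact h _ _
    rw [h']
    exact continuous_finsetSum _ fun r _ =>
      ((continuous_coeff V r).comp continuous_fst).mul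
        ((continuous_coeff V _).comp continuous_snd)
  continuous_neg := by
    refine continuous_iff.2 fun V q => ?_
    exact (continuous_coeff V q).neg

instance : ContinuousSMul ℤ_[p] (IwasawaAlgebra p G) where
  continuous_smul := by
    refine continuous_iff.2 fun V q => ?_
    exact continuous_fst.mul ((continuous_coeff V q).comp continuous_snd)

/-- Compatibility of the components is a closed condition on families of coefficients, so
`ℤ_p⟦G⟧` is closed in a product of copies of `ℤ_p`. -/
instance : CompactSpace (IwasawaAlgebra p G) := by
  have hemb : IsClosedEmbedding
      (fun (a : IwasawaAlgebra p G) (V : OpenSubgroup G) (g : G ⧸ (V : Subgroup G)) =>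
        (a.1 V).coeff g) := by
    refine ⟨⟨⟨rfl⟩, ?_⟩, ?_⟩
    · intro a b h
      refine Subtype.ext (funext fun V => MonoidAlgebra.ext (Finsupp.ext fun q => ?_))
      exact congrFun (congrFun h V) q
    · have := fun V : OpenSubgroup G => quotient_finite V
      -- a function on the finite set `G ⧸ V`, seen as an element of the group algebra
      let e (V : OpenSubgroup G) : ((G ⧸ (V : Subgroup G)) → ℤ_[p]) →ₗ[ℤ_[p]]
          MonoidAlgebra ℤ_[p] (G ⧸ (V : Subgroup G)) :=
        { toFun := fun f => MonoidAlgebra.ofCoeff (Finsupp.equivFunOnFinite.symm f)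
          map_add' := fun f g => by ext; rfl
          map_smul' := fun r f => by ext; rfl }
      have hr : Set.range (fun (a : IwasawaAlgebra p G) (V : OpenSubgroup G)
          (g : G ⧸ (V : Subgroup G)) => (a.1 V).coeff g) =
          ⋂ (V : OpenSubgroup G) (W : OpenSubgroup G) (h : V ≤ W) (q : G ⧸ (W : Subgroup G)),
            {f | (iwasawaTransition p G h (e V (f V))).coeff q = f W q} := by
        ext f
        simp only [Set.mem_range, Set.mem_iInter, Set.mem_ofPred_eq]
        constructor
        · rintro ⟨a, rfl⟩ V W h q
          have : e V ((a.1 V).coeff ·) = a.1 V := by ext; rfl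
          rw [this, a.2 V W h]
        · intro hf
          refine ⟨⟨fun V => e V (f V), fun V W h => ?_⟩, rfl⟩
          ext q
          exact hf V W h q
      rw [hr]
      refine isClosed_iInter fun V => isClosed_iInter fun W => isClosed_iInter fun h =>
        isClosed_iInter fun q => isClosed_eq ?_ ?_
      · let L : ((G ⧸ (V : Subgroup G)) → ℤ_[p]) →ₗ[ℤ_[p]] ℤ_[p] :=
          { toFun := fun f => (iwasawaTransition p G h (e V f)).coeff q
            map_add' := fun f g => by simp
            map_smul' := fun r f => by simp }
        exact (LinearMap.continuous_on_pi L).comp (continuous_apply V)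
      · exact (continuous_apply q).comp (continuous_apply W)
  exact hemb.compactSpace

theorem continuous_map {H : Type*} [CommGroup H] [TopologicalSpace H]
    (f : ContinuousMonoidHom G H) : Continuous (map p f) := by
  refine continuous_iff.2 fun V q => ?_
  exact continuous_linearMap (V.comap f.toMonoidHom f.continuous_toFun)
    ((Finsupp.lapply q : _ →ₗ[ℤ_[p]] ℤ_[p]) ∘ₗ
      (MonoidAlgebra.coeffLinearEquiv ℤ_[p]).toLinearMap ∘ₗ
      (MonoidAlgebra.mapDomainAlgHom ℤ_[p] ℤ_[p]
        (QuotientGroup.map ((V.comap f.toMonoidHom f.continuous_toFun : OpenSubgroup G) :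
          Subgroup G) (V : Subgroup H) f.toMonoidHom le_rfl)).toLinearMap)

theorem hasBasis_basicIdeal :
    (𝓝 (0 : IwasawaAlgebra p G)).HasBasis (fun _ => True)
      fun i : OpenSubgroup G × ℕ => (basicIdeal p i : Set (IwasawaAlgebra p G)) := by
  have hdir : Directed (· ≥ ·) fun i : OpenSubgroup G × ℕ =>
      (basicIdeal p i : Set (IwasawaAlgebra p G)) := by
    intro i j
    have key : ∀ k i : OpenSubgroup G × ℕ, k.1 ≤ i.1 → i.2 ≤ k.2 →
        (basicIdeal p k : Set (IwasawaAlgebra p G)) ⊆ basicIdeal p i := by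
      intro k i h1 h2 a ha
      obtain ⟨y, hy⟩ := mem_basicIdeal.1 ha
      refine mem_basicIdeal.2 ⟨(p : ℤ_[p]) ^ (k.2 - i.2) • iwasawaTransition p G h1 y, ?_⟩
      rw [← a.2 _ _ h1, hy, map_smul, smul_smul, ← pow_add, Nat.add_sub_cancel' h2]
    exact ⟨(i.1 ⊓ j.1, max i.2 j.2), key _ _ inf_le_left (le_max_left _ _),
      key _ _ inf_le_right (le_max_right _ _)⟩
  have h : 𝓝 (0 : IwasawaAlgebra p G) =
      ⨅ i : OpenSubgroup G × ℕ, 𝓟 (basicIdeal p i : Set (IwasawaAlgebra p G)) := by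
    refine le_antisymm (le_iInf fun i => le_principal_iff.2 ?_) ?_
    · have := quotient_finite i.1
      have hopen : ∀ q : G ⧸ (i.1 : Subgroup G), ∀ᶠ a : IwasawaAlgebra p G in 𝓝 0,
          (p : ℤ_[p]) ^ i.2 ∣ (a.1 i.1).coeff q := by
        intro q
        have h1 : Tendsto (fun a : IwasawaAlgebra p G => (a.1 i.1).coeff q) (𝓝 0) (𝓝 0) :=
          (continuous_coeff i.1 q).tendsto 0
        have h2 := h1.eventually (Metric.ball_mem_nhds (0 : ℤ_[p])
          (ε := (p : ℝ) ^ (-(i.2 : ℤ))) (zpow_pos (by exact_mod_cast (Fact.out : p.Prime).pos) _))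
        filter_upwards [h2] with a ha
        rw [← Ideal.mem_span_singleton, ← PadicInt.norm_le_pow_iff_mem_span_pow]
        exact (mem_ball_zero_iff.1 ha).le
      filter_upwards [eventually_all.2 hopen] with a ha
      choose y hy using ha
      refine mem_basicIdeal.2
        ⟨MonoidAlgebra.ofCoeff (Finsupp.equivFunOnFinite.symm y), ?_⟩
      ext q
      rw [hy q]
      rfl
    · change Tendsto id _ _
      refine tendsto_iff.2 fun V q => ?_
      refine Metric.tendsto_nhds.2 fun ε hε => ?_
      obtain ⟨n, hn⟩ := PadicInt.exists_pow_neg_lt p hε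
      refine mem_of_superset (mem_iInf_of_mem (V, n) (mem_principal_self _)) fun a ha => ?_
      obtain ⟨y, hy⟩ := mem_basicIdeal.1 ha
      change dist ((a.1 V).coeff q) 0 < ε
      rw [dist_zero_right]
      refine lt_of_le_of_lt ?_ hn
      rw [PadicInt.norm_le_pow_iff_mem_span_pow, Ideal.mem_span_singleton]
      simp only at hy
      rw [hy]
      exact ⟨y.coeff q, rfl⟩
  rw [h]
  exact hasBasis_iInf_principal hdir

instance : IsLinearTopology (IwasawaAlgebra p G) (IwasawaAlgebra p G) :=
  IsLinearTopology.mk_of_hasBasis _ hasBasis_basicIdeal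

end IwasawaAlgebra

/-! ### Krull dimension after inverting an element -/

/-- Primes of `B[1/x]` contract to primes of `R` strictly below the maximal ideal, and contraction
along an integral extension preserves strict inclusions. -/
theorem ringKrullDim_away_le_of_isIntegral {R B : Type*} [CommRing R] [IsLocalRing R]
    [CommRing B] [Algebra R B] [Algebra.IsIntegral R B] {x : R}
    (hx : x ∈ IsLocalRing.maximalIdeal R) {d : ℕ}
    (hd : (IsLocalRing.maximalIdeal R).height ≤ (d + 1 : ℕ)) :
    ringKrullDim (Localization.Away (algebraMap R B x)) ≤ d := by
  by_contra! hlt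
  have h2 : ((d + 1 : ℕ) : WithBot ℕ∞) ≤
      ringKrullDim (Localization.Away (algebraMap R B x)) := by
    rw [Nat.cast_add, Nat.cast_one]
    exact ENat.WithBot.add_one_le_iff.2 hlt
  obtain ⟨l, hl⟩ := Order.le_krullDim_iff.1 h2
  let c : PrimeSpectrum (Localization.Away (algebraMap R B x)) → PrimeSpectrum R :=
    fun P => ⟨(P.asIdeal.comap (algebraMap B _)).comap (algebraMap R B), inferInstance⟩
  have hc : StrictMono c := by
    intro P P' h
    have h1 : P.asIdeal.comap (algebraMap B _) < P'.asIdeal.comap (algebraMap B _) :=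
      (IsLocalization.orderEmbedding (Submonoid.powers (algebraMap R B x))
        (Localization.Away (algebraMap R B x))).lt_iff_lt.2 h
    exact Ideal.IsIntegral.comap_lt_comap h1
  have hlast : (c l.last).asIdeal < IsLocalRing.maximalIdeal R := by
    refine lt_of_le_of_ne (IsLocalRing.le_maximalIdeal (c l.last).isPrime.ne_top) fun h => ?_
    have hx' : x ∈ (c l.last).asIdeal := h ▸ hx
    exact l.last.isPrime.ne_top (Ideal.eq_top_of_isUnit_mem _ hx'
      (IsLocalization.Away.algebraMap_isUnit (algebraMap R B x)))
  let l' : LTSeries (PrimeSpectrum R) :=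
    (l.map c hc).snoc ⟨IsLocalRing.maximalIdeal R, inferInstance⟩ (by simpa using! hlast)
  have h3 := Order.length_le_height_last (p := l')
  have h4 : Order.height l'.last = (IsLocalRing.maximalIdeal R).height := by
    rw [RelSeries.last_snoc]
    exact (PrimeSpectrum.height_eq_orderHeight _).symm
  rw [h4] at h3
  have h5 := h3.trans hd
  have h6 : l'.length = d + 2 := by simp [l', hl]
  rw [h6] at h5
  have h7 : d + 2 ≤ d + 1 := by exact_mod_cast h5
  omega

/-- A zero-dimensional Noetherian ring has finitely many primes, so infinitely many points with
values in a field force the dimension to be positive. -/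
theorem one_le_ringKrullDim_away {B F : Type*} [CommRing B] [IsNoetherianRing B] [Field F]
    {x b : B} (φ : ℕ → B →+* F) (hx : ∀ k, φ k x ≠ 0) (c : ℕ)
    (hb : ∀ k, φ k b = (c : F) ^ k) (hc : Function.Injective fun k => (c : F) ^ k) :
    1 ≤ ringKrullDim (Localization.Away x) := by
  by_contra! hlt
  let L := Localization.Away x
  have : IsNoetherianRing L := IsLocalization.isNoetherianRing (.powers x) L inferInstance
  have hle : ringKrullDim L ≤ 0 := ENat.WithBot.lt_add_one_iff.1 (by simpa using hlt)
  have : Ring.KrullDimLE 0 L := Ring.krullDimLE_iff.2 hle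
  have : IsArtinianRing L := isArtinianRing_iff_krullDimLE_zero.2 ‹_›
  let ψ : ℕ → L →+* F := fun k => IsLocalization.Away.lift x (hx k).isUnit
  have hψ : ∀ k y, ψ k (algebraMap B L y) = φ k y := fun k y =>
    IsLocalization.Away.lift_eq x (hx k).isUnit y
  refine not_injective_infinite_finite
    (fun k => (⟨RingHom.ker (ψ k), RingHom.ker_isPrime _⟩ : PrimeSpectrum L)) fun k l hkl => ?_
  have hker : RingHom.ker (ψ k) = RingHom.ker (ψ l) := congrArg PrimeSpectrum.asIdeal hkl
  -- `b - c ^ k` lies in the first kernel, hence in the second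
  have hmem : algebraMap B L (b - (c : B) ^ k) ∈ RingHom.ker (ψ k) := by
    rw [RingHom.mem_ker, hψ, map_sub, hb, map_pow, map_natCast, sub_self]
  rw [hker, RingHom.mem_ker, hψ, map_sub, hb, map_pow, map_natCast, sub_eq_zero] at hmem
  exact (hc hmem).symm

theorem RingHom.Finite.quotientMk_ker_comp {R A A' : Type*} [CommRing R] [IsNoetherianRing R]
    [CommRing A] [CommRing A'] (φ : R →+* A) (m : A →+* A') {I : Ideal A} (hI : I = RingHom.ker m)
    (hfin : (m.comp φ).Finite) : ((Ideal.Quotient.mk I).comp φ).Finite := by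
  let l : A ⧸ I →+* A' := Ideal.Quotient.lift I m fun a ha => by rwa [hI] at ha
  have hl : Function.Injective l := RingHom.lift_injective_of_ker_le_ideal I _ hI.ge
  set ρ : R →+* A ⧸ I := (Ideal.Quotient.mk I).comp φ
  set ψ : R →+* A' := m.comp φ
  algebraize [ρ, ψ]
  let j : (A ⧸ I) →ₗ[R] A' :=
    { toFun := l
      map_add' := map_add l
      map_smul' := fun r b => by
        rw [Algebra.smul_def, map_mul]
        rfl }
  exact Module.Finite.of_injective j hl

theorem ringKrullDim_away_eq_one_of_finite {R A F : Type*} [CommRing R] [IsLocalRing R]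
    [IsNoetherianRing R] [CommRing A] [Field F] {I : Ideal A} (φ : R →+* A)
    (hfin : ((Ideal.Quotient.mk I).comp φ).Finite) {p : ℕ}
    (hp : (p : R) ∈ IsLocalRing.maximalIdeal R)
    (hht : (IsLocalRing.maximalIdeal R).height ≤ (1 + 1 : ℕ)) (hpF : (p : F) ≠ 0)
    (Φ : ℕ → A →+* F) (hΦ : ∀ k, ∀ a ∈ I, Φ k a = 0) {b : A} (c : ℕ)
    (hb : ∀ k, Φ k b = (c : F) ^ k) (hc : Function.Injective fun k => (c : F) ^ k) :
    ringKrullDim (Localization.Away (p : A ⧸ I)) = (1 : ℕ) := by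
  set ρ : R →+* A ⧸ I := (Ideal.Quotient.mk I).comp φ
  algebraize [ρ]
  have : IsNoetherianRing (A ⧸ I) := IsNoetherianRing.of_finite R _
  refine le_antisymm ?_ ?_
  · have h := ringKrullDim_away_le_of_isIntegral (B := A ⧸ I) hp hht
    rwa [map_natCast] at h
  · rw [Nat.cast_one]
    refine one_le_ringKrullDim_away (F := F) (b := Ideal.Quotient.mk I b)
      (fun k => Ideal.Quotient.lift I (Φ k) (hΦ k)) (fun k => ?_) c (fun k => ?_) hc
    · rwa [map_natCast]
    · rw [Ideal.Quotient.lift_mk, hb]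

section PowerSeries

open PowerSeries

variable (p : ℕ) [Fact p.Prime]

theorem PadicInt.maximalIdeal_powerSeries :
    IsLocalRing.maximalIdeal ℤ_[p]⟦X⟧ = Ideal.span {(p : ℤ_[p]⟦X⟧), X} := by
  refine le_antisymm (fun f hf => ?_) ?_
  · have h0 : PowerSeries.constantCoeff f ∈ IsLocalRing.maximalIdeal ℤ_[p] := by
      rw [IsLocalRing.mem_maximalIdeal, mem_nonunits_iff] at hf ⊢
      exact fun h => hf (PowerSeries.isUnit_iff_constantCoeff.2 h)
    rw [PadicInt.maximalIdeal_eq_span_p, Ideal.mem_span_singleton] at h0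
    obtain ⟨a, ha⟩ := h0
    rw [Ideal.mem_span_pair]
    refine ⟨C a, PowerSeries.mk fun n => PowerSeries.coeff (n + 1) f, ?_⟩
    conv_rhs => rw [PowerSeries.eq_shift_mul_X_add_const f, ha]
    rw [map_mul, map_natCast]
    ring
  · rw [Ideal.span_le, Set.insert_subset_iff, Set.singleton_subset_iff]
    constructor
    · rw [SetLike.mem_coe, IsLocalRing.mem_maximalIdeal, mem_nonunits_iff,
        PowerSeries.isUnit_iff_constantCoeff, map_natCast]
      exact PadicInt.p_nonunit
    · rw [SetLike.mem_coe, IsLocalRing.mem_maximalIdeal, mem_nonunits_iff,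
        PowerSeries.isUnit_iff_constantCoeff]
      simp

theorem PadicInt.height_maximalIdeal_powerSeries_le :
    (IsLocalRing.maximalIdeal ℤ_[p]⟦X⟧).height ≤ (1 + 1 : ℕ) := by
  classical
  refine (Ideal.height_le_card_of_mem_minimalPrimes_span_finset
    (s := {(p : ℤ_[p]⟦X⟧), X}) ?_).trans (by exact_mod_cast Finset.card_le_two)
  have : Ideal.span (({(p : ℤ_[p]⟦X⟧), X} : Finset ℤ_[p]⟦X⟧) : Set ℤ_[p]⟦X⟧) =
      IsLocalRing.maximalIdeal ℤ_[p]⟦X⟧ := by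
    rw [PadicInt.maximalIdeal_powerSeries]; simp
  rw [this, Ideal.minimalPrimes_eq_subsingleton_self]
  rfl

end PowerSeries

/-! ### Finiteness of `ℤ_p⟦Q⟧` over a power series ring -/

namespace IwasawaAlgebra

open Filter PowerSeries
open scoped PowerSeries.WithPiTopology

variable {p : ℕ} [Fact p.Prime]
variable {G : Type*} [CommGroup G] [TopologicalSpace G]
variable {Q : Type*} [CommGroup Q] [TopologicalSpace Q]

instance : Module.IsTorsionFree ℤ_[p] (IwasawaAlgebra p Q) := by
  refine Module.isTorsionFree_iff_smul_eq_zero.2 fun r a h => or_iff_not_imp_left.2 fun hr => ?_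
  refine Subtype.ext (funext fun V => MonoidAlgebra.ext (Finsupp.ext fun q => ?_))
  have h1 : r * (a.1 V).coeff q = 0 := by
    have h2 : ((r • a : IwasawaAlgebra p Q).1 V).coeff q = 0 := by rw [h]; rfl
    exact h2
  exact (mul_eq_zero.1 h1).resolve_left hr

theorem flat_quotient_of_eq_ker_map (f : ContinuousMonoidHom G Q) {I : ClosedFormalSubscheme p G}
    (hI : I = RingHom.ker (map p f)) : Module.Flat ℤ_[p] (IwasawaAlgebra p G ⧸ I) := by
  let j : (IwasawaAlgebra p G ⧸ I) →ₐ[ℤ_[p]] IwasawaAlgebra p Q :=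
    Ideal.Quotient.liftₐ I (map p f) fun a ha => by rwa [hI] at ha
  have hj : Function.Injective j := by
    refine RingHom.lift_injective_of_ker_le_ideal I _ ?_
    rw [hI]
    rfl
  have : Module.IsTorsionFree ℤ_[p] (IwasawaAlgebra p G ⧸ I) :=
    Function.Injective.moduleIsTorsionFree j hj (map_smul j)
  infer_instance

variable [IsTopologicalGroup G] [CompactSpace G] [IsTopologicalGroup Q] [CompactSpace Q]

/-- Modulo `p`, the element `([g] - 1) ^ (p ^ j)` is `[g ^ (p ^ j)] - 1`. -/
theorem isTopologicallyNilpotent_of_sub_one {g : G}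
    (hg : Tendsto (fun n : ℕ => g ^ p ^ n) atTop (𝓝 1)) :
    IsTopologicallyNilpotent (of p g - 1) := by
  refine hasBasis_basicIdeal.tendsto_right_iff.2 ?_
  rintro ⟨V, n⟩ -
  obtain ⟨j, hj⟩ := (hg.eventually (V.isOpen.mem_nhds (one_mem V))).exists
  have hbase : (of p g - 1) ^ p ^ j ∈ basicIdeal p (V, 1) := by
    obtain ⟨r, hr⟩ := exists_add_pow_prime_pow_eq (Fact.out : p.Prime) (of p g - 1) 1 j
    rw [sub_add_cancel, ← of_pow, one_pow, mul_one, mul_assoc] at hr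
    have h1 : (of p g - 1) ^ p ^ j = of p (g ^ p ^ j) - 1 + p * (-((of p g - 1) * r)) := by
      rw [hr]; ring
    refine mem_basicIdeal.2 ⟨(-((of p g - 1) * r)).1 V, ?_⟩
    have h2 : (of p (g ^ p ^ j) - 1).1 V = 0 := by
      change (of p (g ^ p ^ j)).1 V - 1 = 0
      rw [component_of, (QuotientGroup.eq_one_iff _).2 hj]
      exact sub_self _
    rw [h1]
    change (of p (g ^ p ^ j) - 1).1 V + _ = _
    rw [h2, zero_add, pow_one, Algebra.smul_def, map_natCast]
    rfl
  have hpow : ((of p g - 1) ^ p ^ j) ^ n ∈ basicIdeal p (V, n) := by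
    obtain ⟨y, hy⟩ := mem_basicIdeal.1 hbase
    refine mem_basicIdeal.2 ⟨y ^ n, ?_⟩
    change (((of p g - 1) ^ p ^ j).1 V) ^ n = _
    rw [hy, pow_one, smul_pow]
  filter_upwards [eventually_ge_atTop (p ^ j * n)] with k hk
  rw [← Nat.add_sub_cancel' hk, pow_add, pow_mul]
  exact Ideal.mul_mem_right _ _ hpow

theorem exists_powerSeries_algHom {g : G}
    (hg : Tendsto (fun n : ℕ => g ^ p ^ n) atTop (𝓝 1)) :
    ∃ φ : ℤ_[p]⟦X⟧ →ₐ[ℤ_[p]] IwasawaAlgebra p G,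
      Continuous φ ∧ φ (1 + X) = of p g := by
  let _ : UniformSpace (IwasawaAlgebra p G) := IsTopologicalAddGroup.rightUniformSpace _
  have : IsUniformAddGroup (IwasawaAlgebra p G) := isUniformAddGroup_of_addCommGroup
  have hx : HasEval (of p g - 1) := isTopologicallyNilpotent_of_sub_one hg
  refine ⟨aeval hx, continuous_aeval hx, ?_⟩
  have h := aeval_coe (R := ℤ_[p]) hx (1 + Polynomial.X)
  simpa using h

/-- The module spanned by coset representatives is compact, and contains every group element. -/
theorem finite_powerSeries_algHom {φ : ℤ_[p]⟦X⟧ →ₐ[ℤ_[p]] IwasawaAlgebra p Q} (hφ : Continuous φ)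
    {γ : Q} (hγ : φ (1 + X) = of p γ) (P : OpenSubgroup Q)
    (hP : (P : Set Q) ⊆ closure (Set.range fun n : ℕ => γ ^ n)) :
    (φ : ℤ_[p]⟦X⟧ →+* IwasawaAlgebra p Q).Finite := by
  have := quotient_finite P
  have : CompactSpace ℤ_[p]⟦X⟧ := inferInstanceAs (CompactSpace ((Unit →₀ ℕ) → ℤ_[p]))
  let _ := Fintype.ofFinite (Q ⧸ (P : Subgroup Q))
  let L : ((Q ⧸ (P : Subgroup Q)) → ℤ_[p]⟦X⟧) →ₗ[ℤ_[p]] IwasawaAlgebra p Q :=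
    { toFun := fun c => ∑ i, φ (c i) * of p i.out
      map_add' := fun c d => by
        simp only [Pi.add_apply, map_add, add_mul, Finset.sum_add_distrib]
      map_smul' := fun r c => by
        simp only [Pi.smul_apply, map_smul, smul_mul_assoc, Finset.smul_sum, RingHom.id_apply] }
  have hL : Continuous L := continuous_finsetSum _ fun i _ =>
    (hφ.comp (continuous_apply i)).mul continuous_const
  have hclosed : IsClosed (LinearMap.range L : Set (IwasawaAlgebra p Q)) := by
    rw [LinearMap.coe_range]
    exact (isCompact_range hL).isClosed
  have htop : LinearMap.range L = ⊤ := by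
    refine eq_top_of_isClosed _ hclosed fun q => ?_
    let t : Q ⧸ (P : Subgroup Q) := QuotientGroup.mk q
    have hq : t.out⁻¹ * q ∈ P := QuotientGroup.eq.1 (QuotientGroup.out_eq' t)
    have hsub : closure (Set.range fun n : ℕ => γ ^ n) ⊆
        {y | of p (y * t.out) ∈ LinearMap.range L} := by
      refine closure_minimal ?_ (hclosed.preimage
        (continuous_of.comp (continuous_id.mul continuous_const)))
      rintro _ ⟨n, rfl⟩
      classical
      refine ⟨Pi.single t ((1 + X) ^ n), ?_⟩
      change ∑ i, φ (Pi.single (M := fun _ => ℤ_[p]⟦X⟧) t ((1 + X) ^ n) i) * of p i.out = _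
      rw [Finset.sum_eq_single t]
      · rw [Pi.single_eq_same, map_pow, hγ, of_mul, of_pow]
      · intro i _ hi
        rw [Pi.single_eq_of_ne hi, map_zero, zero_mul]
      · simp
    have := hsub (hP hq)
    simpa [mul_comm t.out⁻¹, mul_assoc] using this
  algebraize [(φ : ℤ_[p]⟦X⟧ →+* IwasawaAlgebra p Q)]
  refine Module.Finite.of_surjective
    (Fintype.linearCombination ℤ_[p]⟦X⟧ fun i : Q ⧸ (P : Subgroup Q) => of p i.out) fun a => ?_
  have ha : a ∈ LinearMap.range L := htop ▸ Submodule.mem_top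
  exact ha

/-- If `f g` topologically generates an open subgroup, then `ℤ_p⟦Q⟧`, and with it the image of
`ℤ_p⟦G⟧`, is finite over `ℤ_p⟦X⟧`, where `1 + X` acts as `[g]`. -/
theorem isFlatOfDim_one_ker_map (f : ContinuousMonoidHom G Q) {g : G}
    (hg : Tendsto (fun n : ℕ => g ^ p ^ n) atTop (𝓝 1)) (P : OpenSubgroup Q)
    (hP : (P : Set Q) ⊆ closure (Set.range fun n : ℕ => f g ^ n)) {c : ℕ} (hc : 2 ≤ c)
    (hpt : ∀ k : ℕ, ∃ κ : ContinuousMonoidHom G (PadicAlgCl p)ˣ,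
      ClosedFormalSubscheme.HasPoint (RingHom.ker (map p f)) κ ∧ (κ g : PadicAlgCl p) = c ^ k) :
    ClosedFormalSubscheme.IsFlatOfDim (RingHom.ker (map p f) : ClosedFormalSubscheme p G) 1 := by
  obtain ⟨φ, hφ, hφg⟩ := exists_powerSeries_algHom (p := p) hg
  obtain ⟨I, hI⟩ : ∃ I : ClosedFormalSubscheme p G, I = RingHom.ker (map p f) := ⟨_, rfl⟩
  have hfin : ((map p f : IwasawaAlgebra p G →+* IwasawaAlgebra p Q).comp
      (φ : ℤ_[p]⟦X⟧ →+* IwasawaAlgebra p G)).Finite :=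
    finite_powerSeries_algHom (φ := (map p f).comp φ) ((continuous_map f).comp hφ)
      (by rw [AlgHom.comp_apply, hφg, map_of]) P hP
  choose κ hκ hκg using hpt
  choose Φ _ hΦ hΦI using hκ
  refine ⟨flat_quotient_of_eq_ker_map f rfl, ?_⟩
  refine ringKrullDim_away_eq_one_of_finite (F := PadicAlgCl p)
    (φ : ℤ_[p]⟦X⟧ →+* IwasawaAlgebra p G)
    (RingHom.Finite.quotientMk_ker_comp _ _ rfl hfin) ?_
    (PadicInt.height_maximalIdeal_powerSeries_le p)
    (by exact_mod_cast (Fact.out : p.Prime).ne_zero) Φ hΦI (b := of p g) c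
    (fun k => by rw [hΦ, hκg]) fun k l h => ?_
  · rw [PadicInt.maximalIdeal_powerSeries]
    exact Ideal.subset_span (Set.mem_insert _ _)
  · refine Nat.pow_right_injective hc (Nat.cast_injective (R := PadicAlgCl p) ?_)
    simpa using h

end IwasawaAlgebra

/-! ### Extending characters to Iwasawa algebras -/

namespace IwasawaAlgebra

open Filter

variable {p : ℕ} [Fact p.Prime]
variable {Q : Type*} [CommGroup Q] [TopologicalSpace Q]

theorem norm_character_eq_one [CompactSpace Q] (χ : ContinuousMonoidHom Q (PadicAlgCl p)ˣ) (q : Q) :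
    ‖(χ q : PadicAlgCl p)‖ = 1 := by
  have hcont : Continuous fun q => ‖(χ q : PadicAlgCl p)‖ :=
    (Units.continuous_val.comp χ.continuous_toFun).norm
  obtain ⟨C, hC⟩ := (isCompact_range hcont).bddAbove
  have hle : ∀ q, ‖(χ q : PadicAlgCl p)‖ ≤ 1 := by
    intro q
    by_contra! h
    obtain ⟨n, hn⟩ := pow_unbounded_of_one_lt C h
    have := hC ⟨q ^ n, rfl⟩
    simp only [map_pow, Units.val_pow_eq_pow_val, norm_pow] at this
    exact absurd this hn.not_ge
  refine le_antisymm (hle q) ?_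
  have h := hle q⁻¹
  rw [map_inv, Units.val_inv_eq_inv_val, norm_inv] at h
  exact (inv_le_one₀ (norm_pos_iff.2 (χ q).ne_zero)).1 h

theorem norm_padicIntToAlgCl_le (c : ℤ_[p]) : ‖padicIntToAlgCl p c‖ ≤ 1 := by
  have : ‖padicIntToAlgCl p c‖ = ‖(c : ℚ_[p])‖ := norm_algebraMap' (PadicAlgCl p) (c : ℚ_[p])
  rw [this]
  exact c.norm_le_one

/-- The open subgroup on which a character is congruent to `1` modulo `2⁻ⁿ`. -/
def congruenceSubgroup [CompactSpace Q] (χ : ContinuousMonoidHom Q (PadicAlgCl p)ˣ) (n : ℕ) :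
    OpenSubgroup Q where
  carrier := {q | ‖(χ q : PadicAlgCl p) - 1‖ < (1 / 2) ^ n}
  one_mem' := by simp
  mul_mem' := by
    intro a b ha hb
    have h : ((χ (a * b) : (PadicAlgCl p)ˣ) : PadicAlgCl p) - 1 =
        χ a * ((χ b : PadicAlgCl p) - 1) + ((χ a : PadicAlgCl p) - 1) := by
      rw [map_mul, Units.val_mul]; ring
    change ‖((χ (a * b) : (PadicAlgCl p)ˣ) : PadicAlgCl p) - 1‖ < _
    rw [h]
    refine (IsUltrametricDist.norm_add_le_max _ _).trans_lt (max_lt ?_ ha)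
    rw [norm_mul, norm_character_eq_one, one_mul]
    exact hb
  inv_mem' := by
    intro a ha
    have h : ((χ a⁻¹ : (PadicAlgCl p)ˣ) : PadicAlgCl p) - 1 =
        -((χ a⁻¹ : PadicAlgCl p) * ((χ a : PadicAlgCl p) - 1)) := by
      rw [mul_sub, ← Units.val_mul, ← map_mul, inv_mul_cancel, map_one]; simp
    change ‖((χ a⁻¹ : (PadicAlgCl p)ˣ) : PadicAlgCl p) - 1‖ < _
    rw [h, norm_neg, norm_mul, norm_character_eq_one, one_mul]
    exact ha
  isOpen' := isOpen_lt
    ((Units.continuous_val.comp χ.continuous_toFun).sub continuous_const).norm continuous_const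

variable [CompactSpace Q] (χ : ContinuousMonoidHom Q (PadicAlgCl p)ˣ)

theorem congruenceSubgroup_anti {m n : ℕ} (h : n ≤ m) :
    congruenceSubgroup χ m ≤ congruenceSubgroup χ n := fun _ hq =>
  lt_of_lt_of_le (b := (1 / 2 : ℝ) ^ m) hq
    (pow_le_pow_of_le_one (by norm_num) (by norm_num) h)

theorem norm_character_sub_le {n : ℕ} {a b : Q}
    (h : (QuotientGroup.mk a : Q ⧸ (congruenceSubgroup χ n : Subgroup Q)) = QuotientGroup.mk b) :
    ‖(χ a : PadicAlgCl p) - χ b‖ ≤ (1 / 2) ^ n := by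
  have h1 : ‖(χ (a⁻¹ * b) : PadicAlgCl p) - 1‖ < (1 / 2) ^ n := QuotientGroup.eq.1 h
  have h2 : (χ a : PadicAlgCl p) - χ b = -(χ a * ((χ (a⁻¹ * b) : PadicAlgCl p) - 1)) := by
    rw [mul_sub, ← Units.val_mul, ← map_mul, mul_inv_cancel_left]; ring
  rw [h2, norm_neg, norm_mul, norm_character_eq_one, one_mul]
  exact h1.le

/-- The Riemann sum of a character against the component in `ℤ_p[G/V_n]` of a measure. -/
def riemannSum (n : ℕ) :
    MonoidAlgebra ℤ_[p] (Q ⧸ (congruenceSubgroup χ n : Subgroup Q)) →+ PadicAlgCl p :=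
  (Finsupp.liftAddHom fun q =>
    (AddMonoidHom.mulRight (χ q.out : PadicAlgCl p)).comp
      (padicIntToAlgCl p).toAddMonoidHom).comp
    (MonoidAlgebra.coeffAddEquiv (R := ℤ_[p])).toAddMonoidHom

theorem riemannSum_single (n : ℕ) (q : Q ⧸ (congruenceSubgroup χ n : Subgroup Q)) (c : ℤ_[p]) :
    riemannSum χ n (MonoidAlgebra.single q c) = padicIntToAlgCl p c * χ q.out := by
  simp [riemannSum, MonoidAlgebra.coeff_single]

theorem norm_le_of_map_add {M : Type*} {T : MonoidAlgebra ℤ_[p] M → PadicAlgCl p}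
    (hT : ∀ x y, T (x + y) = T x + T y) {ε : ℝ}
    (hε : 0 ≤ ε) (h : ∀ m c, ‖T (MonoidAlgebra.single m c)‖ ≤ ε) (x) : ‖T x‖ ≤ ε := by
  induction x using MonoidAlgebra.induction_linear with
  | zero =>
    have h0 : T 0 = 0 := by simpa using hT 0 0
    rwa [h0, norm_zero]
  | add x y hx hy =>
    rw [hT]
    exact (IsUltrametricDist.norm_add_le_max _ _).trans (max_le hx hy)
  | single m c => exact h m c

theorem norm_riemannSum_single_mul_single_sub_le (n : ℕ)
    (q r : Q ⧸ (congruenceSubgroup χ n : Subgroup Q)) (c d : ℤ_[p]) :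
    ‖riemannSum χ n (MonoidAlgebra.single q c * MonoidAlgebra.single r d) -
      riemannSum χ n (MonoidAlgebra.single q c) * riemannSum χ n (MonoidAlgebra.single r d)‖ ≤
      (1 / 2) ^ n := by
  rw [MonoidAlgebra.single_mul_single, riemannSum_single, riemannSum_single, riemannSum_single]
  have h : padicIntToAlgCl p (c * d) * (χ (q * r).out : PadicAlgCl p) -
      padicIntToAlgCl p c * χ q.out * (padicIntToAlgCl p d * χ r.out) =
      padicIntToAlgCl p (c * d) * ((χ (q * r).out : PadicAlgCl p) - χ (q.out * r.out)) := by
    rw [map_mul, map_mul, Units.val_mul]; ring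
  rw [h, norm_mul, ← one_mul ((1 / 2 : ℝ) ^ n)]
  refine mul_le_mul (norm_padicIntToAlgCl_le _) (norm_character_sub_le χ ?_) (norm_nonneg _)
    zero_le_one
  rw [QuotientGroup.mk_mul, QuotientGroup.out_eq', QuotientGroup.out_eq', QuotientGroup.out_eq']

theorem norm_riemannSum_mul_sub_le (n : ℕ)
    (x y : MonoidAlgebra ℤ_[p] (Q ⧸ (congruenceSubgroup χ n : Subgroup Q))) :
    ‖riemannSum χ n (x * y) - riemannSum χ n x * riemannSum χ n y‖ ≤ (1 / 2) ^ n := by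
  have hε : (0 : ℝ) ≤ (1 / 2) ^ n := by positivity
  refine norm_le_of_map_add
    (T := fun y => riemannSum χ n (x * y) - riemannSum χ n x * riemannSum χ n y)
    (fun y z => ?_) hε (fun r d => ?_) y
  · rw [mul_add, map_add, map_add]; ring
  refine norm_le_of_map_add
    (T := fun x => riemannSum χ n (x * MonoidAlgebra.single r d) -
      riemannSum χ n x * riemannSum χ n (MonoidAlgebra.single r d))
    (fun y z => ?_) hε (fun q c => norm_riemannSum_single_mul_single_sub_le χ n q r c d) x
  rw [add_mul, map_add, map_add]; ring

theorem norm_riemannSum_sub_transition_le {m n : ℕ} (h : n ≤ m)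
    (x : MonoidAlgebra ℤ_[p] (Q ⧸ (congruenceSubgroup χ m : Subgroup Q))) :
    ‖riemannSum χ m x -
      riemannSum χ n (iwasawaTransition p Q (congruenceSubgroup_anti χ h) x)‖ ≤ (1 / 2) ^ n := by
  refine norm_le_of_map_add (T := fun x => riemannSum χ m x -
      riemannSum χ n (iwasawaTransition p Q (congruenceSubgroup_anti χ h) x))
    (fun y z => ?_) (by positivity) (fun q c => ?_) x
  · rw [map_add, map_add, map_add]; ring
  have h1 : iwasawaTransition p Q (congruenceSubgroup_anti χ h) (MonoidAlgebra.single q c) =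
      MonoidAlgebra.single (QuotientGroup.mk q.out) c := by
    simp only [iwasawaTransition, MonoidAlgebra.mapDomainAlgHom_apply,
      MonoidAlgebra.mapDomain_single]
    conv_lhs => rw [← QuotientGroup.out_eq' q]
    rfl
  rw [h1, riemannSum_single, riemannSum_single, ← mul_sub, norm_mul,
    ← one_mul ((1 / 2 : ℝ) ^ n)]
  refine mul_le_mul (norm_padicIntToAlgCl_le _) (norm_character_sub_le χ ?_) (norm_nonneg _)
    zero_le_one
  rw [QuotientGroup.out_eq']

/-- A character with values in a finite extension of `ℚ_p` extends to `ℤ_p⟦Q⟧`: its Riemann sums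
converge, uniformly, because the extension is complete. -/
theorem exists_ringHom_of_character [IsTopologicalGroup Q]
    {E : IntermediateField ℚ_[p] (PadicAlgCl p)}
    [FiniteDimensional ℚ_[p] E] (hE : ∀ q, (χ q : PadicAlgCl p) ∈ E) :
    ∃ Φ : IwasawaAlgebra p Q →+* PadicAlgCl p, Continuous Φ ∧ ∀ q, Φ (of p q) = χ q := by
  let s : ℕ → IwasawaAlgebra p Q → PadicAlgCl p := fun n a =>
    riemannSum χ n (a.1 (congruenceSubgroup χ n))
  have hε : Tendsto (fun n : ℕ => (1 / 2 : ℝ) ^ n) atTop (𝓝 0) :=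
    tendsto_pow_atTop_nhds_zero_of_lt_one (by norm_num) (by norm_num)
  have hsub : ∀ {m n : ℕ} (_ : n ≤ m) a, ‖s m a - s n a‖ ≤ (1 / 2) ^ n := by
    intro m n h a
    have := norm_riemannSum_sub_transition_le χ h (a.1 (congruenceSubgroup χ m))
    rwa [a.2 _ _ (congruenceSubgroup_anti χ h)] at this
  have hmem : ∀ n a, s n a ∈ (Subalgebra.toSubmodule E.toSubalgebra) := by
    intro n a
    change riemannSum χ n _ ∈ E
    simp only [riemannSum, AddMonoidHom.comp_apply, Finsupp.liftAddHom_apply]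
    refine sum_mem fun q _ => mul_mem (IntermediateField.algebraMap_mem E _) (hE _)
  have hlim : ∀ a, ∃ y, Tendsto (fun n => s n a) atTop (𝓝 y) := by
    intro a
    have hc : CauchySeq fun n => s n a := by
      refine cauchySeq_of_le_tendsto_0' (fun n => (1 / 2 : ℝ) ^ n) (fun n m h => ?_) hε
      rw [dist_comm, dist_eq_norm]
      exact hsub h a
    have hE' : IsComplete (Subalgebra.toSubmodule E.toSubalgebra : Set (PadicAlgCl p)) := by
      have : FiniteDimensional ℚ_[p] (Subalgebra.toSubmodule E.toSubalgebra) :=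
        inferInstanceAs (FiniteDimensional ℚ_[p] E)
      exact Submodule.complete_of_finiteDimensional _
    obtain ⟨y, _, hy⟩ := cauchySeq_tendsto_of_isComplete hE' (fun n => hmem n a) hc
    exact ⟨y, hy⟩
  choose Φ hΦ using hlim
  have hadd : ∀ a b, Φ (a + b) = Φ a + Φ b := fun a b =>
    tendsto_nhds_unique (hΦ (a + b)) (((hΦ a).add (hΦ b)).congr fun n =>
      (map_add (riemannSum χ n) _ _).symm)
  have hmul : ∀ a b, Φ (a * b) = Φ a * Φ b := by
    intro a b
    refine sub_eq_zero.1 (tendsto_nhds_unique ((hΦ (a * b)).sub ((hΦ a).mul (hΦ b))) ?_)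
    exact squeeze_zero_norm (fun n => norm_riemannSum_mul_sub_le χ n _ _) hε
  have hof : ∀ q, Φ (of p q) = χ q := by
    intro q
    refine sub_eq_zero.1 (tendsto_nhds_unique ((hΦ (of p q)).sub_const _) ?_)
    refine squeeze_zero_norm (fun n => ?_) hε
    change ‖riemannSum χ n (MonoidAlgebra.single _ 1) - _‖ ≤ _
    rw [riemannSum_single, map_one, one_mul]
    exact norm_character_sub_le χ (QuotientGroup.out_eq' _)
  refine ⟨RingHom.mk' ⟨⟨Φ, ?_⟩, hmul⟩ hadd, ?_, hof⟩
  · have := hof 1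
    rwa [of_one, map_one, Units.val_one] at this
  · change Continuous Φ
    have hunif : TendstoUniformly s Φ atTop := by
      refine Metric.tendstoUniformly_iff.2 fun ε hε0 => ?_
      filter_upwards [hε.eventually (gt_mem_nhds hε0)] with n hn a
      refine lt_of_le_of_lt ?_ hn
      rw [dist_eq_norm]
      refine le_of_tendsto ((hΦ a).sub_const _).norm ?_
      filter_upwards [eventually_ge_atTop n] with m hm
      exact hsub hm a
    refine hunif.continuous (Frequently.of_forall fun n => ?_)
    have := quotient_finite (congruenceSubgroup χ n)
    let _ := Fintype.ofFinite (Q ⧸ (congruenceSubgroup χ n : Subgroup Q))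
    have hs : s n = fun a => ∑ q : Q ⧸ (congruenceSubgroup χ n : Subgroup Q),
        padicIntToAlgCl p ((a.1 (congruenceSubgroup χ n)).coeff q) * χ q.out := by
      funext a
      change riemannSum χ n _ = _
      simp only [riemannSum, AddMonoidHom.comp_apply, Finsupp.liftAddHom_apply]
      rw [Finsupp.sum_fintype _ _ (by simp)]
      rfl
    rw [hs]
    refine continuous_finsetSum _ fun q _ => ?_
    have h : Continuous fun a : IwasawaAlgebra p Q =>
        padicIntToAlgCl p ((a.1 (congruenceSubgroup χ n)).coeff q) :=
      ((continuous_algebraMap ℚ_[p] (PadicAlgCl p)).comp continuous_subtype_val).comp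
        (continuous_coeff _ q)
    exact h.mul continuous_const

/-- Characters pulled back along `f` are points of the closed formal subscheme defined by `f`. -/
theorem hasPoint_ker_map [IsTopologicalGroup Q] {G : Type*} [CommGroup G] [TopologicalSpace G]
    [IsTopologicalGroup G] [CompactSpace G] (f : ContinuousMonoidHom G Q)
    {E : IntermediateField ℚ_[p] (PadicAlgCl p)}
    [FiniteDimensional ℚ_[p] E] (hE : ∀ q, (χ q : PadicAlgCl p) ∈ E)
    {κ : ContinuousMonoidHom G (PadicAlgCl p)ˣ} (hκ : ∀ g, κ g = χ (f g)) :
    ClosedFormalSubscheme.HasPoint (RingHom.ker (map p f)) κ := by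
  obtain ⟨Φ, hΦ, hΦχ⟩ := exists_ringHom_of_character χ hE
  refine ⟨Φ.comp (map p f : IwasawaAlgebra p G →+* IwasawaAlgebra p Q),
    hΦ.comp (continuous_map f), fun g => ?_, fun a ha => ?_⟩
  · rw [hκ, ← hΦχ, ← map_of]
    rfl
  · have h : map p f a = 0 := ha
    change Φ (map p f a) = 0
    rw [h, map_zero]

end IwasawaAlgebra

/-! ### The ring `𝒪_{K,p}` -/

namespace OKp

open Filter

variable (p : ℕ) [Fact p.Prime] (K : Type*) [Field K]

variable {p K} in
theorem onePlus_anti {r s : ℕ} (h : r ≤ s) : onePlus p K s ⊆ onePlus p K r := by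
  rintro x ⟨y, hy⟩
  refine ⟨p ^ (s - r) * y, ?_⟩
  rw [hy, ← mul_assoc, ← pow_add, Nat.add_sub_cancel' h]

variable {K} in
/-- The inclusion `𝒪_K → 𝒪_{K,p}`. -/
def ofInt : 𝓞 K →+* OKp p K :=
  (Algebra.TensorProduct.includeRight : 𝓞 K →ₐ[ℤ] ℤ_[p] ⊗[ℤ] 𝓞 K).toRingHom

variable {p K}

theorem embed_ofInt (σ : K →+* PadicAlgCl p) (a : 𝓞 K) : embed p σ (ofInt p a) = σ a := by
  refine (Algebra.TensorProduct.productMap_apply_tmul ..).trans ?_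
  exact (congrArg (· * σ a) (map_one (padicIntToAlgCl p))).trans (one_mul _)

theorem embed_algebraMap (σ : K →+* PadicAlgCl p) (c : ℤ_[p]) :
    embed p σ (algebraMap ℤ_[p] (OKp p K) c) = padicIntToAlgCl p c := by
  refine (Algebra.TensorProduct.productMap_apply_tmul ..).trans ?_
  exact (congrArg (padicIntToAlgCl p c * ·) (map_one σ)).trans (mul_one _)

theorem continuous_padicIntToAlgCl : Continuous (padicIntToAlgCl p) :=
  (continuous_algebraMap ℚ_[p] (PadicAlgCl p)).comp continuous_subtype_val

theorem continuous_embed (σ : K →+* PadicAlgCl p) : Continuous (embed p σ) := by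
  refine IsModuleTopology.continuous_of_ringHom (R := ℤ_[p]) _ ?_
  have h : ((embed p σ).comp (algebraMap ℤ_[p] (OKp p K)) : ℤ_[p] → PadicAlgCl p) =
      padicIntToAlgCl p := funext (embed_algebraMap σ)
  rw [h]
  exact continuous_padicIntToAlgCl

variable (p K) [NumberField K]

/-- `𝒪_{K,p}` is homeomorphic to a power of `ℤ_p`. -/
def equivFun : OKp p K ≃L[ℤ_[p]] (Module.Free.ChooseBasisIndex ℤ_[p] (OKp p K) → ℤ_[p]) :=
  { (Module.Free.chooseBasis ℤ_[p] (OKp p K)).equivFun with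
    continuous_toFun := IsModuleTopology.continuous_of_linearMap
      (Module.Free.chooseBasis ℤ_[p] (OKp p K)).equivFun.toLinearMap
    continuous_invFun := IsModuleTopology.continuous_of_linearMap
      (Module.Free.chooseBasis ℤ_[p] (OKp p K)).equivFun.symm.toLinearMap }

instance : T2Space (OKp p K) := (equivFun p K).toHomeomorph.symm.t2Space

instance : CompactSpace (OKp p K) := (equivFun p K).toHomeomorph.symm.compactSpace

variable {p K}

theorem exists_pow_mul_mem {W : Set (OKp p K)} (hW : W ∈ 𝓝 0) :
    ∃ r : ℕ, ∀ y : OKp p K, (p : OKp p K) ^ r * y ∈ W := by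
  have hp : Tendsto (fun r : ℕ => (p : ℤ_[p]) ^ r) atTop (𝓝 0) :=
    tendsto_pow_atTop_nhds_zero_of_norm_lt_one (PadicInt.mem_nonunits.1 PadicInt.p_nonunit)
  have h1 : ∀ᶠ c : ℤ_[p] in 𝓝 0, ∀ y ∈ (Set.univ : Set (OKp p K)), c • y ∈ W := by
    refine isCompact_univ.eventually_forall_of_forall_eventually fun y _ => ?_
    refine (continuous_smul.tendsto ((0 : ℤ_[p]), y)).eventually_mem ?_
    rwa [zero_smul]
  obtain ⟨r, hr⟩ := (hp.eventually h1).exists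
  refine ⟨r, fun y => ?_⟩
  have := hr y trivial
  rwa [Algebra.smul_def, map_pow, map_natCast] at this

theorem isOpen_range_pow_mul (r : ℕ) :
    IsOpen {x : OKp p K | ∃ y, x = (p : OKp p K) ^ r * y} := by
  have h : {x : OKp p K | ∃ y, x = (p : OKp p K) ^ r * y} =
      equivFun p K ⁻¹' (Set.univ.pi fun _ => {c | ‖c‖ < (p : ℝ) ^ (-(r : ℤ) + 1)}) := by
    ext x
    simp only [Set.mem_preimage, Set.mem_pi, Set.mem_univ, true_implies, Set.mem_ofPred_eq,
      PadicInt.norm_lt_pow_iff_norm_le_pow_sub_one, add_sub_cancel_right,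
      PadicInt.norm_le_pow_iff_mem_span_pow, Ideal.mem_span_singleton]
    have key : ∀ y, equivFun p K ((p : OKp p K) ^ r * y) = (p : ℤ_[p]) ^ r • equivFun p K y := by
      intro y
      rw [← map_smul, Algebra.smul_def, map_pow, map_natCast]
    constructor
    · rintro ⟨y, rfl⟩ i
      rw [key]
      exact ⟨_, rfl⟩
    · intro hx
      choose y hy using hx
      refine ⟨(equivFun p K).symm y, (equivFun p K).injective ?_⟩
      rw [key, ContinuousLinearEquiv.apply_symm_apply]
      exact funext hy
  rw [h]
  exact (isOpen_set_pi Set.finite_univ fun _ _ => isOpen_lt _root_.continuous_norm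
    continuous_const).preimage
    (equivFun p K).continuous

variable (p K) in
/-- `onePlus` as an open subgroup. -/
def onePlusSubgroup (r : ℕ) : OpenSubgroup (OKp p K)ˣ where
  carrier := onePlus p K r
  one_mem' := ⟨0, by simp⟩
  mul_mem' := by
    rintro a b ⟨x, hx⟩ ⟨y, hy⟩
    refine ⟨x + y + p ^ r * (x * y), ?_⟩
    rw [Units.val_mul, hx, hy]; ring
  inv_mem' := by
    rintro a ⟨x, hx⟩
    refine ⟨-((a⁻¹ : (OKp p K)ˣ) * x), ?_⟩
    have h : ((a⁻¹ : (OKp p K)ˣ) : OKp p K) * a = 1 := a.inv_mul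
    rw [hx] at h
    linear_combination h
  isOpen' := by
    have h : onePlus p K r = (fun x : (OKp p K)ˣ => (x : OKp p K) - 1) ⁻¹'
        {x : OKp p K | ∃ y, x = (p : OKp p K) ^ r * y} := by
      ext x
      exact exists_congr fun y => by rw [sub_eq_iff_eq_add']
    rw [h]
    exact (isOpen_range_pow_mul r).preimage (Units.continuous_val.sub continuous_const)

theorem mem_onePlusSubgroup {r : ℕ} {x : (OKp p K)ˣ} :
    x ∈ onePlusSubgroup p K r ↔ x ∈ onePlus p K r := Iff.rfl

theorem exists_onePlus_subset {V : Set (OKp p K)ˣ} (hV : V ∈ 𝓝 1) :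
    ∃ r, onePlus p K r ⊆ V := by
  rw [Units.isEmbedding_embedProduct.nhds_eq_comap, mem_comap] at hV
  obtain ⟨t, ht, htV⟩ := hV
  rw [map_one, Prod.one_eq_mk, nhds_prod_eq] at ht
  obtain ⟨A, hA, B, hB, hAB⟩ := mem_prod_iff.1 ht
  have shift : ∀ {C : Set (OKp p K)}, C ∈ 𝓝 1 → ∃ r : ℕ, ∀ y, 1 + (p : OKp p K) ^ r * y ∈ C := by
    intro C hC
    have hC' : (fun x : OKp p K => 1 + x) ⁻¹' C ∈ 𝓝 0 :=
      (continuous_const_add (1 : OKp p K)).continuousAt.preimage_mem_nhds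
        (by rwa [add_zero])
    exact exists_pow_mul_mem hC'
  obtain ⟨r, hr⟩ := shift hA
  obtain ⟨s, hs⟩ := shift (C := MulOpposite.op ⁻¹' B)
    (MulOpposite.continuous_op.continuousAt.preimage_mem_nhds hB)
  refine ⟨max r s, fun x hx => htV (hAB ⟨?_, ?_⟩)⟩
  · obtain ⟨y, hy⟩ := onePlus_anti (le_max_left r s) hx
    change (x : OKp p K) ∈ A
    rw [hy]
    exact hr y
  · have hx' : x⁻¹ ∈ onePlus p K (max r s) := (onePlusSubgroup p K (max r s)).inv_mem' hx
    obtain ⟨y, hy⟩ := onePlus_anti (le_max_right r s) hx'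
    change ((x⁻¹ : (OKp p K)ˣ) : OKp p K) ∈ MulOpposite.op ⁻¹' B
    rw [hy]
    exact hs y

/-! ### The norm as a product over embeddings -/

theorem norm_ofInt (a : 𝓞 K) :
    Algebra.norm ℤ_[p] (ofInt p a) = (Algebra.norm ℤ a : ℤ) := by
  have h : (LinearMap.mul ℤ_[p] (ℤ_[p] ⊗[ℤ] 𝓞 K)) (1 ⊗ₜ a) =
      (LinearMap.mul ℤ (𝓞 K) a).baseChange ℤ_[p] := by
    ext b
    simp
  change LinearMap.det (LinearMap.mul ℤ_[p] (ℤ_[p] ⊗[ℤ] 𝓞 K) (1 ⊗ₜ a)) = _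
  rw [h, LinearMap.det_baseChange]
  rfl

theorem dense_range_ofInt : DenseRange (ofInt p : 𝓞 K → OKp p K) := by
  intro x
  let M : AddSubgroup (OKp p K) :=
    (ofInt p : 𝓞 K →+* OKp p K).toAddMonoidHom.range.topologicalClosure
  change x ∈ M
  have hM : IsClosed (M : Set (OKp p K)) := AddSubgroup.isClosed_topologicalClosure _
  have hmem : ∀ a, ofInt p a ∈ M := fun a => AddSubgroup.le_topologicalClosure _ ⟨a, rfl⟩
  have hpure : ∀ (z : ℤ_[p]) (a : 𝓞 K), z • ofInt p a ∈ M := by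
    intro z a
    have hc : Continuous fun z : ℤ_[p] => z • ofInt p a :=
      continuous_smul.comp (continuous_id.prodMk continuous_const)
    refine (PadicInt.denseRange_intCast (p := p)).induction_on z (hM.preimage hc) fun n => ?_
    change (n : ℤ_[p]) • ofInt p a ∈ M
    rw [Int.cast_smul_eq_zsmul]
    exact zsmul_mem (hmem a) n
  change (x : ℤ_[p] ⊗[ℤ] 𝓞 K) ∈ (M : Set (OKp p K))
  refine TensorProduct.induction_on (motive := fun y : ℤ_[p] ⊗[ℤ] 𝓞 K => y ∈ (M : Set (OKp p K))) x
    (zero_mem M) (fun z a => ?_) (fun x y hx hy => M.add_mem hx hy)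
  have h : (z ⊗ₜ[ℤ] a : ℤ_[p] ⊗[ℤ] 𝓞 K) = z • (1 ⊗ₜ[ℤ] a) := by
    rw [TensorProduct.smul_tmul', smul_eq_mul, mul_one]
  rw [h]
  exact hpure z a

theorem padicIntToAlgCl_norm (x : OKp p K) :
    padicIntToAlgCl p (Algebra.norm ℤ_[p] x) = ∏ σ : K →+* PadicAlgCl p, embed p σ x := by
  refine dense_range_ofInt.induction_on x
    (isClosed_eq (continuous_padicIntToAlgCl.comp (OKp.continuous_norm p K))
      (continuous_finsetProd _ fun σ _ => continuous_embed σ)) fun a => ?_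
  have h := Algebra.norm_eq_prod_embeddings ℚ (PadicAlgCl p) (a : K)
  rw [← Algebra.coe_norm_int] at h
  rw [norm_ofInt, map_intCast]
  simp only [embed_ofInt]
  rw [map_intCast] at h
  rw [h]
  exact (Fintype.prod_equiv (RingHom.equivRatAlgHom K (PadicAlgCl p)) _ _ fun _ => rfl).symm

end OKp

/-! ### Odd functions on embeddings, and CM subfields -/

namespace NumberField

open ComplexEmbedding

/-- A totally complex field with an automorphism inducing complex conjugation under every complex
embedding is CM. -/
theorem isCMField_of_forall_isConj (F : Type*) [Field F] [NumberField F] [IsTotallyComplex F]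
    {α : Gal(F/ℚ)} (hα : ∀ φ : F →+* ℂ, IsConj φ α) : IsCMField F := by
  let φ : F →+* ℂ := Classical.choice inferInstance
  have hcard : Nat.card (Subgroup.zpowers α) = 2 := by
    rw [Nat.card_zpowers, orderOf_isConj_two_of_ne_one (hα φ)]
    exact (isConj_ne_one_iff (hα φ)).mpr <| IsTotallyComplex.complexEmbedding_not_isReal φ
  have : Finite (Subgroup.zpowers α) := Nat.finite_of_card_ne_zero (by positivity)
  let E : IntermediateField ℚ F := IntermediateField.fixedField (Subgroup.zpowers α)
  have hαE : α ∈ E.fixingSubgroup := by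
    rw [IntermediateField.fixingSubgroup_fixedField]
    exact Subgroup.mem_zpowers α
  have : IsTotallyReal E := ⟨fun w ↦ by
    obtain ⟨W, rfl⟩ := w.comap_surjective (K := F)
    change (W.comap (algebraMap E F)).IsReal
    rw [← InfinitePlace.mk_embedding W, InfinitePlace.comap_mk, InfinitePlace.isReal_mk_iff]
    exact ComplexEmbedding.IsConj.isReal_comp
      (σ := IntermediateField.fixingSubgroupEquiv E ⟨α, hαE⟩)
      (hα W.embedding)⟩
  have : Algebra.IsQuadraticExtension E F :=
    ⟨by rw [IntermediateField.finrank_fixedField_eq_card, hcard]⟩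
  exact IsCMField.ofCMExtension E F

variable {K L : Type*} [Field K] [NumberField K] [Field L] [NumberField L] [IsGalois ℚ L]

/-- Every complex embedding of a field `F ⊆ L` is the restriction of a conjugate of a given
embedding of `L`. -/
theorem exists_gal_of_algHom (ι : L →+* ℂ) {F : Type*} [Field F] [NumberField F] (s : F →ₐ[ℚ] L)
    (φ : F →+* ℂ) : ∃ τ : Gal(L/ℚ), ∀ x, φ x = ι (τ (s x)) := by
  algebraize [(s : F →+* L)]
  have : Algebra.IsAlgebraic F L := Algebra.IsAlgebraic.tower_top (K := ℚ) F
  obtain ⟨τ, hτ⟩ := ComplexEmbedding.exists_comp_symm_eq_of_comp_eq (k := ℚ) ι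
    (ComplexEmbedding.lift L φ) (Subsingleton.elim _ _)
  refine ⟨τ.symm, fun x => ?_⟩
  rw [← ComplexEmbedding.lift_algebraMap_apply L φ x, ← hτ]
  rfl

/-- A function on the embeddings of `K` that is odd under every conjugate of complex conjugation
vanishes: the largest normal subgroup `N` that leaves it invariant contains the quotients of these
conjugates, and if it were nonzero at `s`, then the elements that `s` maps into the fixed field of
`N` would form a CM subfield. -/
theorem eq_zero_of_forall_conj_neg (hK : ∀ F : IntermediateField ℚ K, ¬ IsCMField F)
    (ι : L →+* ℂ) {c : Gal(L/ℚ)} (hc : IsConj ι c) (m : (K →ₐ[ℚ] L) → ℤ)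
    (hm : ∀ (τ : Gal(L/ℚ)) σ, m (((τ⁻¹ * c * τ : Gal(L/ℚ)) : L →ₐ[ℚ] L).comp σ) = -m σ)
    (s : K →ₐ[ℚ] L) : m s = 0 := by
  have hact : ∀ (g h : Gal(L/ℚ)) (σ : K →ₐ[ℚ] L),
      ((g * h : Gal(L/ℚ)) : L →ₐ[ℚ] L).comp σ =
        (g : L →ₐ[ℚ] L).comp ((h : L →ₐ[ℚ] L).comp σ) := fun _ _ _ => rfl
  have hact1 : ∀ σ : K →ₐ[ℚ] L, ((1 : Gal(L/ℚ)) : L →ₐ[ℚ] L).comp σ = σ := fun _ => rfl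
  let W : Subgroup Gal(L/ℚ) :=
    { carrier := {g | ∀ σ, m ((g : L →ₐ[ℚ] L).comp σ) = m σ}
      one_mem' := fun σ => by rw [hact1]
      mul_mem' := fun {a b} ha hb σ => by rw [hact, ha, hb]
      inv_mem' := fun {a} ha σ => by rw [← ha, ← hact, mul_inv_cancel, hact1] }
  -- `N` is the largest normal subgroup under which `m` is invariant
  let N : Subgroup Gal(L/ℚ) := W.normalCore
  have hN : ∀ τ, c⁻¹ * (τ⁻¹ * c * τ) ∈ N := by
    intro τ g σ
    have h1 : g * (c⁻¹ * (τ⁻¹ * c * τ)) * g⁻¹ =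
        ((g⁻¹)⁻¹ * c * g⁻¹)⁻¹ * ((τ * g⁻¹)⁻¹ * c * (τ * g⁻¹)) := by group
    have h2 : ∀ σ', m ((((g⁻¹)⁻¹ * c * g⁻¹)⁻¹ : Gal(L/ℚ)) |>.toAlgHom.comp σ') = -m σ' := by
      intro σ'
      have := hm g⁻¹ ((((g⁻¹)⁻¹ * c * g⁻¹)⁻¹ : Gal(L/ℚ)).toAlgHom.comp σ')
      erw [← hact, mul_inv_cancel, hact1] at this
      rw [this, neg_neg]
    rw [h1, hact]
    refine (h2 _).trans ?_
    rw [hm, neg_neg]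
  let H : Subgroup Gal(L/ℚ) := s.fieldRange.fixingSubgroup
  let M : Subgroup Gal(L/ℚ) := N ⊔ H
  have hMc : ∀ a ∈ M, c⁻¹ * a * c ∈ M := by
    intro a ha
    have h1 : c⁻¹ * a * c = a * (c⁻¹ * ((a)⁻¹ * c * a))⁻¹ := by group
    rw [h1]
    exact mul_mem ha (inv_mem (Subgroup.mem_sup_left (hN a)))
  let F : IntermediateField ℚ K := (IntermediateField.fixedField M).comap s
  have hF : ∀ x : F, ∀ a ∈ M, a (s x) = s x := fun x a ha => x.2 ⟨a, ha⟩
  have hFix : ∀ y ∈ IntermediateField.fixedField M, ∃ x : F, s x = y := by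
    intro y hy
    have h1 : y ∈ IntermediateField.fixedField H := fun a =>
      hy ⟨a.1, Subgroup.mem_sup_right a.2⟩
    rw [IsGalois.fixedField_fixingSubgroup] at h1
    obtain ⟨x, rfl⟩ := h1
    exact ⟨⟨x, hy⟩, rfl⟩
  have hcF : ∀ x : F, ∃ y : F, s y = c (s x) := by
    intro x
    refine hFix _ fun a => ?_
    have h1 := hF x _ (hMc a.1 a.2)
    have h2 : a.1 * c = c * (c⁻¹ * a.1 * c) := by group
    change (a.1 * c) (s x) = c (s x)
    rw [h2]
    exact congrArg c h1
  choose α hα using hcF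
  have hsF : Function.Injective fun x : F => s x := s.injective.comp Subtype.val_injective
  let αF : F →ₐ[ℚ] F := RingHom.toRatAlgHom
    { toFun := α
      map_one' := hsF (by simp [hα])
      map_mul' := fun x y => hsF (by simp [hα])
      map_zero' := hsF (by simp [hα])
      map_add' := fun x y => hsF (by simp [hα]) }
  let αE : Gal(F/ℚ) := AlgEquiv.ofBijective αF (Algebra.IsAlgebraic.algHom_bijective αF)
  have hconj : ∀ φ : F →+* ℂ, IsConj φ αE := by
    intro φ
    obtain ⟨τ, hτ⟩ := exists_gal_of_algHom ι (s.comp F.val) φ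
    refine RingHom.ext fun x => ?_
    change star (φ x) = φ (α x)
    rw [hτ, hτ, ← hc.eq]
    change ι (c (τ (s x))) = ι (τ (s (α x)))
    rw [hα]
    have h1 : c * τ = τ * c * (c⁻¹ * (τ⁻¹ * c * τ)) := by group
    have h2 := hF x _ (Subgroup.mem_sup_left (hN τ))
    refine congrArg ι ?_
    change (c * τ) (s x) = τ (c (s x))
    rw [h1]
    exact congrArg (fun y => τ (c y)) h2
  by_contra hms
  have htc : IsTotallyComplex F := by
    refine ⟨fun w => ?_⟩
    rw [← InfinitePlace.mk_embedding w, InfinitePlace.isComplex_mk_iff]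
    intro hreal
    have h1 : αE = 1 := by
      by_contra hne
      exact (isConj_ne_one_iff (hconj w.embedding)).1 hne hreal
    -- a real embedding of `F` would put complex conjugation into `M`
    have h2 : c ∈ (IntermediateField.fixedField M).fixingSubgroup := by
      rintro ⟨y, hy⟩
      obtain ⟨x, rfl⟩ := hFix y hy
      change c (s x) = s x
      rw [← hα]
      exact congrArg (fun a : Gal(F/ℚ) => s (a x)) h1
    rw [IntermediateField.fixingSubgroup_fixedField] at h2
    obtain ⟨n, hn, h, hh, rfl⟩ := Subgroup.mem_sup_of_normal_left.1 h2
    have h3 := hm 1 s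
    rw [inv_one, one_mul, mul_one, hact] at h3
    have h4 : (h : L →ₐ[ℚ] L).comp s = s := AlgHom.ext fun x => hh ⟨s x, x, rfl⟩
    rw [h4, W.normalCore_le hn s] at h3
    exact hms (by omega)
  exact hK F (isCMField_of_forall_isConj F hconj)

/-! ### Linear relations between the logarithms of units -/

open NumberField.Units Units.dirichletUnitTheorem in
/-- The logarithms of the absolute values of the units satisfy no linear relation but the product
formula, by the unit theorem. -/
theorem eq_of_forall_sum_mult_log_eq_zero (b : InfinitePlace K → ℝ)
    (h : ∀ u : (𝓞 K)ˣ, ∑ w : InfinitePlace K, b w * (w.mult * Real.log (w (u : K))) = 0)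
    (w : InfinitePlace K) : b w = b w₀ := by
  classical
  by_cases hw : w = w₀
  · rw [hw]
  let f : logSpace K →ₗ[ℝ] ℝ := ∑ v : {v : InfinitePlace K // v ≠ w₀},
    (b v - b w₀) • LinearMap.proj v
  have hf : f = 0 := by
    refine LinearMap.ext_on (unitLattice_span_eq_top K) ?_
    rintro _ ⟨u, -, rfl⟩
    have h1 : ∑ v : InfinitePlace K, (b v - b w₀) * (v.mult * Real.log (v (u.toMul : K))) = 0 := by
      simp only [sub_mul, Finset.sum_sub_distrib, ← Finset.mul_sum, sum_mult_mul_log, mul_zero,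
        sub_zero]
      exact h _
    rw [Fintype.sum_eq_add_sum_subtype_ne _ w₀, sub_self, zero_mul, zero_add] at h1
    simpa [f, LinearMap.sum_apply] using! h1
  have h2 : f (Pi.single ⟨w, hw⟩ 1) = 0 := by rw [hf]; rfl
  have h3 : f (Pi.single ⟨w, hw⟩ 1) = b w - b w₀ := by
    simp only [f, LinearMap.sum_apply, LinearMap.smul_apply, LinearMap.proj_apply, smul_eq_mul]
    rw [Finset.sum_eq_single ⟨w, hw⟩]
    · simp
    · intro v _ hv
      simp [Pi.single_eq_of_ne hv]
    · simp
  linarith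

/-- In an additive relation between the logarithms of the conjugates of the units, two complex
conjugate embeddings always have the same total weight. -/
theorem exists_add_conjugate_eq (n : (K →+* ℂ) → ℝ)
    (h : ∀ u : (𝓞 K)ˣ, ∑ φ : K →+* ℂ, n φ * Real.log ‖φ (u : K)‖ = 0) :
    ∃ k, ∀ φ, n φ + n (conjugate φ) = k := by
  classical
  let b : InfinitePlace K → ℝ := fun w => n w.embedding + n (conjugate w.embedding)
  have hb : ∀ φ, n φ + n (conjugate φ) = b (InfinitePlace.mk φ) := by
    intro φ
    rcases InfinitePlace.embedding_mk_eq φ with h1 | h1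
    · simp only [b, h1]
    · simp only [b, h1]
      rw [star_involutive (R := K →+* ℂ) φ |> fun h => show conjugate (conjugate φ) = φ from h,
        add_comm]
  refine ⟨b Units.dirichletUnitTheorem.w₀, fun φ => ?_⟩
  rw [hb]
  refine eq_of_forall_sum_mult_log_eq_zero b (fun u => ?_) _
  have h1 : ∑ φ : K →+* ℂ, n (conjugate φ) * Real.log ‖φ (u : K)‖ = 0 := by
    rw [← h u]
    refine Fintype.sum_equiv (Function.Involutive.toPerm conjugate (star_involutive)) _ _
      fun φ => ?_
    simp
  have h2 : ∑ φ : K →+* ℂ, b (InfinitePlace.mk φ) * Real.log (InfinitePlace.mk φ (u : K)) = 0 := by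
    simp only [← hb, add_mul, Finset.sum_add_distrib, InfinitePlace.apply, h, h1, add_zero]
  rw [← h2, ← Finset.sum_fiberwise Finset.univ InfinitePlace.mk]
  refine Finset.sum_congr rfl fun w _ => ?_
  rw [Finset.sum_congr rfl (g := fun _ => b w * Real.log (w (u : K))) fun φ hφ => by
    rw [(Finset.mem_filter.1 hφ).2], Finset.sum_const, InfinitePlace.card_filter_mk_eq,
    nsmul_eq_mul]
  ring

end NumberField

/-! ### Multiplicative relations between the conjugates of units -/

namespace NumberField

open ComplexEmbedding

section Weil

variable {K : Type*} [Field K] [NumberField K]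

/-- Once the normal closure is embedded in `Ω`, the embeddings of `K` in `Ω` are its embeddings in
the normal closure. -/
theorem bijective_comp_algHom_normalClosure {Ω : Type*} [Field Ω] [CharZero Ω] [IsAlgClosed Ω]
    (i : IntermediateField.normalClosure ℚ K (AlgebraicClosure ℚ) →+* Ω) :
    Function.Bijective
      fun s : K →ₐ[ℚ] IntermediateField.normalClosure ℚ K (AlgebraicClosure ℚ) =>
        i.comp (s : K →+* IntermediateField.normalClosure ℚ K (AlgebraicClosure ℚ)) := by
  rw [Fintype.bijective_iff_injective_and_card]
  refine ⟨fun s t h => AlgHom.ext fun x => i.injective (RingHom.congr_fun h x), ?_⟩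
  rw [Embeddings.card, ← AlgHom.card ℚ K (AlgebraicClosure ℚ)]
  exact Fintype.card_congr (normalClosure.algHomEquiv ℚ K (AlgebraicClosure ℚ))

/-- The integers `n σ` such that `u ↦ ∏ σ(u) ^ n σ` is torsion on the units are all equal if `K`
has no CM subfield: by the unit theorem, `n σ + n (c σ)` is the same for all `σ` and all conjugates
`c` of complex conjugation, so that `n`, shifted to have mean zero, is odd under every `c`.
The Galois action takes place on the embeddings of `K` in its normal closure `L`, which are
identified with those in `Ω` and, for each `τ`, with those in `ℂ` by way of `ι ∘ τ`. -/
theorem eq_of_forall_units_prod_pow_eq_one {Ω : Type*} [Field Ω] [CharZero Ω] [IsAlgClosed Ω]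
    (hK : ∀ F : IntermediateField ℚ K, ¬ IsCMField F) (n : (K →+* Ω) → ℤ)
    (hn : ∀ u : (𝓞 K)ˣ, ∃ k : ℕ, 0 < k ∧ ∏ σ : K →+* Ω, (σ ((u ^ k : (𝓞 K)ˣ) : K)) ^ n σ = 1)
    (σ σ' : K →+* Ω) : n σ = n σ' := by
  classical
  let L := IntermediateField.normalClosure ℚ K (AlgebraicClosure ℚ)
  have : NumberField L := { }
  have : Normal ℚ (AlgebraicClosure ℚ) := by
    -- the two `ℚ`-algebra structures on the algebraic closure agree propositionally only
    have h := @IsAlgClosure.normal ℚ (AlgebraicClosure ℚ) _ _ (AlgebraicClosure.instAlgebra ℚ)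
      inferInstance
    convert h
    exact Subsingleton.elim _ _
  have : Normal ℚ L := normalClosure.normal ℚ K (AlgebraicClosure ℚ)
  have : IsGalois ℚ L := IsGalois.mk
  let i : L →+* Ω := (IsAlgClosed.lift : L →ₐ[ℚ] Ω)
  let ι : L →+* ℂ := Classical.choice inferInstance
  let eΩ : (K →ₐ[ℚ] L) ≃ (K →+* Ω) := Equiv.ofBijective _ (bijective_comp_algHom_normalClosure i)
  obtain ⟨c, hc⟩ := exists_gal_of_algHom ι (AlgHom.id ℚ L) (conjugate ι)
  have hc' : IsConj ι c := RingHom.ext hc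
  let m : (K →ₐ[ℚ] L) → ℤ := fun s => n (eΩ s)
  let act : Gal(L/ℚ) → (K →ₐ[ℚ] L) → (K →ₐ[ℚ] L) := fun g s => (g : L →ₐ[ℚ] L).comp s
  -- the relation in `L`
  have hL : ∀ u : (𝓞 K)ˣ, ∃ k : ℕ, 0 < k ∧ ∏ s : K →ₐ[ℚ] L, (s (u : K) ^ k) ^ m s = 1 := by
    intro u
    obtain ⟨k, hk, h⟩ := hn u
    refine ⟨k, hk, i.injective ?_⟩
    rw [map_one, ← h, map_prod, ← eΩ.prod_comp]
    refine Fintype.prod_congr _ _ fun s => ?_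
    rw [map_zpow₀, map_pow, Units.val_pow_eq_pow_val, map_pow, map_pow]
    rfl
  have hpair : ∀ τ : Gal(L/ℚ), ∃ k : ℝ, ∀ s, (m s : ℝ) + m (act (τ⁻¹ * c * τ) s) = k := by
    intro τ
    let eC : (K →ₐ[ℚ] L) ≃ (K →+* ℂ) := Equiv.ofBijective _
      (bijective_comp_algHom_normalClosure (ι.comp (τ : L →+* L)))
    obtain ⟨k, hk⟩ := exists_add_conjugate_eq (K := K) (fun φ => (m (eC.symm φ) : ℝ)) (fun u => by
      obtain ⟨k, hk0, h⟩ := hL u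
      have h1 : Real.log ‖ι (τ (∏ s : K →ₐ[ℚ] L, (s (u : K) ^ k) ^ m s))‖ = 0 := by
        rw [h, map_one, map_one, norm_one, Real.log_one]
      rw [map_prod, map_prod, norm_prod, Real.log_prod] at h1
      · have h2 : ∀ s : K →ₐ[ℚ] L, Real.log ‖ι (τ ((s (u : K) ^ k) ^ m s))‖ =
            k * (m s * Real.log ‖eC s (u : K)‖) := by
          intro s
          rw [map_zpow₀, map_zpow₀, norm_zpow, Real.log_zpow, map_pow, map_pow, norm_pow,
            Real.log_pow]
          simp only [eC, Equiv.ofBijective_apply]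
          change _ = k * (m s * Real.log ‖ι (τ (s (u : K)))‖)
          ring
        simp only [h2, ← Finset.mul_sum] at h1
        have h3 := (mul_eq_zero.1 h1).resolve_left (by exact_mod_cast hk0.ne')
        rw [← h3, ← eC.sum_comp]
        simp
      · intro s _
        rw [norm_ne_zero_iff, map_ne_zero, map_ne_zero]
        refine zpow_ne_zero _ (pow_ne_zero _ ((map_ne_zero s).2 ?_))
        exact Units.coe_ne_zero u)
    refine ⟨k, fun s => ?_⟩
    rw [← hk (eC s)]
    have h : conjugate (eC s) = eC (act (τ⁻¹ * c * τ) s) := by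
      refine RingHom.ext fun x => ?_
      change star (ι (τ (s x))) = ι (τ ((τ⁻¹ * c * τ) (s x)))
      rw [← hc'.eq]
      have : c * τ = τ * (τ⁻¹ * c * τ) := by group
      exact congrArg ι (congrArg (fun g : Gal(L/ℚ) => g (s x)) this)
    simp only [h, Equiv.symm_apply_apply]
  let d : ℤ := Fintype.card (K →ₐ[ℚ] L)
  let t : ℤ := ∑ s, m s
  have hodd : ∀ (τ : Gal(L/ℚ)) s,
      d * m (act (τ⁻¹ * c * τ) s) - t = -(d * m s - t) := by
    intro τ s
    obtain ⟨k, hk⟩ := hpair τ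
    have hbij : ∑ s, m (act (τ⁻¹ * c * τ) s) = t := by
      refine Function.Bijective.sum_comp (Finite.injective_iff_bijective.1 fun a b hab => ?_) m
      exact AlgHom.ext fun x => (τ⁻¹ * c * τ).injective (AlgHom.congr_fun hab x)
    have hsum : (t : ℝ) + t = d * k := by
      have h1 : ∑ s, ((m s : ℝ) + m (act (τ⁻¹ * c * τ) s)) = ∑ _s : K →ₐ[ℚ] L, k :=
        Fintype.sum_congr _ _ hk
      rw [Finset.sum_add_distrib, Finset.sum_const, nsmul_eq_mul, Finset.card_univ] at h1
      have h2 : ((∑ s, m (act (τ⁻¹ * c * τ) s) : ℤ) : ℝ) = t := by rw [hbij]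
      push_cast at h2
      rw [h2] at h1
      simpa [t, d] using h1
    have h3 : ((d * m (act (τ⁻¹ * c * τ) s) - t : ℤ) : ℝ) = (-(d * m s - t) : ℤ) := by
      push_cast
      linear_combination (d : ℝ) * hk s - hsum
    exact_mod_cast h3
  have hzero : ∀ s, d * m s - t = 0 := fun s =>
    eq_zero_of_forall_conj_neg hK ι hc' (fun s => d * m s - t) (fun τ s => hodd τ s) s
  have hd : d ≠ 0 := by
    have : Nonempty (K →ₐ[ℚ] L) := ⟨eΩ.symm σ⟩
    exact Int.natCast_ne_zero.2 Fintype.card_ne_zero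
  have key := (hzero (eΩ.symm σ)).trans (hzero (eΩ.symm σ')).symm
  simp only [m, Equiv.apply_symm_apply] at key
  exact mul_left_cancel₀ hd (by linarith)

end Weil

end NumberField

/-! ### Global units in `Γ(U)` -/

section CongruenceNeighbourhoods

open HeightOneSpectrum Filter

variable {K : Type*} [Field K] [NumberField K]

/-- A neighbourhood of `1` in the completed local ring contains all elements congruent to `1`
modulo a suitable nonzero global integer. -/
theorem IsDedekindDomain.HeightOneSpectrum.exists_mul_mem_nhds (v : HeightOneSpectrum (𝓞 K))
    {t : Set (v.adicCompletionIntegers K)} (ht : t ∈ 𝓝 1) :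
    ∃ c : 𝓞 K, c ≠ 0 ∧ ∀ x : v.adicCompletionIntegers K,
      (x : v.adicCompletion K) - 1 ∈ (fun y => ((c : K) : v.adicCompletion K) * y) ''
        (v.adicCompletionIntegers K : Set (v.adicCompletion K)) → x ∈ t := by
  obtain ⟨s, hs, hst⟩ := mem_nhds_induced _ _ _ |>.1 ht
  obtain ⟨γ, hγ⟩ := Valued.mem_nhds.1 hs
  obtain ⟨a, ha, ha0⟩ := Submodule.exists_mem_ne_zero_of_ne_bot v.ne_bot
  obtain ⟨n, hn⟩ := exists_pow_lt₀ ((v.valuation_lt_one_iff_mem (K := K) a).2 ha)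
    (Units.map (MonoidWithZeroHom.ValueGroup₀.embedding
      (f := (.ofClass (Valued.v (R := v.adicCompletion K))))) γ)
  refine ⟨a ^ n, pow_ne_zero _ ha0, ?_⟩
  rintro x ⟨y, hy, hxy⟩
  refine hst (hγ ?_)
  change Valued.v.restrict ((x : v.adicCompletion K) - 1) < _
  rw [← hxy, Valuation.restrict_lt_iff_lt_embedding, map_mul]
  refine lt_of_le_of_lt ?_ hn
  rw [valuedAdicCompletion_eq_valuation', ← map_pow, ← map_pow]
  exact mul_le_of_le_one_right' hy

variable {p : ℕ}

/-- Congruences of algebraic integers control the topology of the adeles away from `p`. -/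
theorem AdelesAway.exists_one_add_mul_mem {W : Set (AdelesAway p K)} (hW : W ∈ 𝓝 1) :
    ∃ d : 𝓞 K, d ≠ 0 ∧ ∀ x : 𝓞 K, AdelesAway.diag p K (1 + d * x : 𝓞 K) ∈ W := by
  classical
  have hone : (1 : AdelesAway p K) = RestrictedProduct.structureMap _ _ cofinite 1 := rfl
  have hopen : ∀ v : {v : HeightOneSpectrum (𝓞 K) // (p : 𝓞 K) ∉ v.asIdeal},
      IsOpen (v.1.adicCompletionIntegers K : Set (v.1.adicCompletion K)) :=
    fun _ => Valued.isOpen_valuationSubring _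
  rw [hone, RestrictedProduct.nhds_eq_map_structureMap hopen, mem_map, nhds_pi, mem_pi] at hW
  obtain ⟨I, hI, t, ht, hsub⟩ := hW
  choose c hc0 hc using fun v : {v : HeightOneSpectrum (𝓞 K) // (p : 𝓞 K) ∉ v.asIdeal} =>
    v.1.exists_mul_mem_nhds (K := K) (ht v)
  refine ⟨∏ v ∈ hI.toFinset, c v, Finset.prod_ne_zero_iff.2 fun v _ => hc0 v, fun x => ?_⟩
  set d := ∏ v ∈ hI.toFinset, c v
  have hmem : (fun v : {v : HeightOneSpectrum (𝓞 K) // (p : 𝓞 K) ∉ v.asIdeal} =>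
      (⟨(((1 + d * x : 𝓞 K) : K) : v.1.adicCompletion K),
        coe_algebraMap_mem (𝓞 K) K v.1 _⟩ : v.1.adicCompletionIntegers K)) ∈ I.pi t := by
    intro v hv
    obtain ⟨e, he⟩ := Finset.dvd_prod_of_mem c (hI.mem_toFinset.2 hv)
    refine hc v _ ⟨(((e * x : 𝓞 K) : K) : v.1.adicCompletion K),
      coe_algebraMap_mem (𝓞 K) K v.1 _, ?_⟩
    change ((c v : K) : v.1.adicCompletion K) * (((e * x : 𝓞 K) : K) : v.1.adicCompletion K) =
      (((1 + d * x : 𝓞 K) : K) : v.1.adicCompletion K) - 1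
    rw [eq_sub_iff_add_eq', ← adicCompletion.coe_mul, ← adicCompletion.coe_one,
      ← adicCompletion.coe_add]
    refine congrArg (fun k : K => (k : v.1.adicCompletion K)) ?_
    rw [show d = c v * e from he]
    push_cast
    ring
  exact hsub hmem

/-- Every unit of `𝒪_K` has a positive power in a given open subgroup of the ideles away
from `p`. -/
theorem AdelesAway.exists_pow_mem {U : Subgroup (AdelesAway p K)ˣ}
    (hU : IsOpen (U : Set (AdelesAway p K)ˣ)) (u : (𝓞 K)ˣ) :
    ∃ a : ℕ, 0 < a ∧
      Units.map ((AdelesAway.diag p K).comp (algebraMap (𝓞 K) K)).toMonoidHom (u ^ a) ∈ U := by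
  have h1 := hU.mem_nhds U.one_mem
  rw [Units.isEmbedding_embedProduct.nhds_eq_comap, mem_comap] at h1
  obtain ⟨t, ht, htU⟩ := h1
  rw [map_one, Prod.one_eq_mk, nhds_prod_eq] at ht
  obtain ⟨A, hA, B, hB, hAB⟩ := mem_prod_iff.1 ht
  obtain ⟨d, hd0, hd⟩ := AdelesAway.exists_one_add_mul_mem hA
  obtain ⟨e, he0, he⟩ := AdelesAway.exists_one_add_mul_mem (W := MulOpposite.op ⁻¹' B)
    (MulOpposite.continuous_op.continuousAt.preimage_mem_nhds hB)
  have hfin : Finite (𝓞 K ⧸ Ideal.span {d * e}) :=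
    Ring.HasFiniteQuotients.finiteQuotient
      (by rw [Ne, Ideal.span_singleton_eq_bot]; exact mul_ne_zero hd0 he0)
  obtain ⟨a, ha0, ha⟩ := isOfFinOrder_iff_pow_eq_one.1 (isOfFinOrder_of_finite
    (Units.map (Ideal.Quotient.mk (Ideal.span {d * e})).toMonoidHom u))
  have key : ∀ w : (𝓞 K)ˣ,
      Units.map (Ideal.Quotient.mk (Ideal.span {d * e})).toMonoidHom w = 1 →
      ∃ x : 𝓞 K, (w : 𝓞 K) = 1 + d * e * x := by
    intro w hw
    have h : Ideal.Quotient.mk (Ideal.span {d * e}) (w : 𝓞 K) = 1 := congrArg Units.val hw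
    rw [← map_one (Ideal.Quotient.mk (Ideal.span {d * e})), Ideal.Quotient.eq,
      Ideal.mem_span_singleton] at h
    obtain ⟨x, hx⟩ := h
    exact ⟨x, by rw [← hx]; ring⟩
  refine ⟨a, ha0, htU (hAB ⟨?_, ?_⟩)⟩
  · obtain ⟨x, hx⟩ := key (u ^ a) (by rw [map_pow, ha])
    change AdelesAway.diag p K (((u ^ a : (𝓞 K)ˣ) : 𝓞 K) : K) ∈ A
    rw [hx, mul_assoc]
    exact hd _
  · obtain ⟨x, hx⟩ := key (u ^ a)⁻¹ (by rw [map_inv, map_pow, ha, inv_one])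
    change AdelesAway.diag p K ((((u ^ a)⁻¹ : (𝓞 K)ˣ) : 𝓞 K) : K) ∈ MulOpposite.op ⁻¹' B
    rw [hx, mul_comm d e, mul_assoc]
    exact he _

end CongruenceNeighbourhoods

section Infinity

variable {K : Type*} [Field K]

open mixedEmbedding

/-- The square of a unit lies in the identity component of `(K ⊗ ℝ)ˣ`. -/
theorem sq_mem_infIdentityComponent (x : (mixedSpace K)ˣ) :
    x ^ 2 ∈ infIdentityComponent K := by
  have hne1 : ∀ w, (x : mixedSpace K).1 w ≠ 0 := fun w h0 => by
    have := congrFun (congrArg Prod.fst x.mul_inv) w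
    rw [Prod.fst_mul, Pi.mul_apply, h0, zero_mul] at this
    exact zero_ne_one this
  have hne2 : ∀ w, (x : mixedSpace K).2 w ≠ 0 := fun w h0 => by
    have := congrFun (congrArg Prod.snd x.mul_inv) w
    rw [Prod.snd_mul, Pi.mul_apply, h0, zero_mul] at this
    exact zero_ne_one this
  let f : ℝ → mixedSpace K := fun t =>
    (fun w => Real.exp (t * Real.log ((x : mixedSpace K).1 w ^ 2)),
      fun w => Complex.exp (t * Complex.log ((x : mixedSpace K).2 w ^ 2)))
  have hf : Continuous f := by
    refine Continuous.prodMk (continuous_pi fun w => ?_) (continuous_pi fun w => ?_)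
    · fun_prop
    · fun_prop
  have hmul : ∀ t, f t * f (-t) = 1 := fun t => by
    refine Prod.ext (funext fun w => ?_) (funext fun w => ?_)
    · change Real.exp _ * Real.exp _ = 1
      rw [← Real.exp_add, neg_mul, add_neg_cancel, Real.exp_zero]
    · change Complex.exp _ * Complex.exp _ = 1
      rw [← Complex.exp_add, Complex.ofReal_neg, neg_mul, add_neg_cancel, Complex.exp_zero]
  let g : ℝ → (mixedSpace K)ˣ := fun t =>
    ⟨f t, f (-t), hmul t, by rw [mul_comm, hmul]⟩
  have hg : Continuous g := Units.continuous_iff.2 ⟨hf, hf.comp continuous_neg⟩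
  have h0 : g 0 = 1 := Units.ext <| by
    refine Prod.ext (funext fun w => ?_) (funext fun w => ?_)
    · change Real.exp _ = 1
      rw [zero_mul, Real.exp_zero]
    · change Complex.exp _ = 1
      rw [Complex.ofReal_zero, zero_mul, Complex.exp_zero]
  have h1 : g 1 = x ^ 2 := Units.ext <| by
    refine Prod.ext (funext fun w => ?_) (funext fun w => ?_)
    · change Real.exp _ = (x : mixedSpace K).1 w ^ 2
      rw [one_mul, Real.exp_log (sq_pos_of_ne_zero (hne1 w))]
    · change Complex.exp _ = (x : mixedSpace K).2 w ^ 2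
      rw [Complex.ofReal_one, one_mul, Complex.exp_log (pow_ne_zero _ (hne2 w))]
  exact (isPreconnected_range hg).subset_connectedComponent ⟨0, h0⟩ ⟨1, h1⟩

end Infinity

section UnitsInLevel

variable {p : ℕ} [Fact p.Prime] {K : Type*} [Field K] [NumberField K]

namespace OKp

theorem toKp_ofInt (a : 𝓞 K) :
    toKp p K (ofInt p a) = (Algebra.TensorProduct.includeRight : K →ₐ[ℚ] ℚ_[p] ⊗[ℚ] K) a := by
  refine (Algebra.TensorProduct.productMap_apply_tmul ..).trans ?_
  refine Eq.trans ?_ (one_mul _)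
  refine congrArg (· * _) ?_
  exact map_one ((Algebra.TensorProduct.includeLeftRingHom : ℚ_[p] →+* ℚ_[p] ⊗[ℚ] K).comp
      PadicInt.Coe.ringHom)

end OKp

/-- Every unit of `𝒪_K` has a positive power in `Γ(U)`, and even in its intersection with a given
open subgroup of `𝒪_{K,p}ˣ`. -/
theorem exists_pow_mem_gammaLevel {U : Subgroup (AdelesAway p K)ˣ}
    (hU : IsOpen (U : Set (AdelesAway p K)ˣ)) (P : OpenSubgroup (OKp p K)ˣ) (u : (𝓞 K)ˣ) :
    ∃ m : ℕ, 0 < m ∧ Units.map (OKp.ofInt p : 𝓞 K →+* OKp p K).toMonoidHom (u ^ m) ∈ gammaLevel U ∧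
      Units.map (OKp.ofInt p : 𝓞 K →+* OKp p K).toMonoidHom (u ^ m) ∈ P := by
  obtain ⟨a, ha0, ha⟩ := AdelesAway.exists_pow_mem hU u
  have hfin : Finite ((OKp p K)ˣ ⧸ (P : Subgroup (OKp p K)ˣ)) :=
    Subgroup.quotient_finite_of_isOpen _ P.isOpen
  obtain ⟨b, hb0, hb⟩ := isOfFinOrder_iff_pow_eq_one.1 (isOfFinOrder_of_finite
    (QuotientGroup.mk' (P : Subgroup (OKp p K)ˣ)
      (Units.map (OKp.ofInt p : 𝓞 K →+* OKp p K).toMonoidHom u)))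
  refine ⟨a * b * 2, by positivity, ?_, ?_⟩
  · refine ⟨Units.map (algebraMap (𝓞 K) K).toMonoidHom (u ^ (a * b * 2)), ⟨?_, ?_⟩, ?_⟩
    · rw [mul_assoc, pow_mul, map_pow]
      exact Subgroup.pow_mem _ (show _ ∈ U.comap (Units.map (AdelesAway.diag p K).toMonoidHom)
        from ha) (b * 2)
    · change Units.map (mixedEmbedding K).toMonoidHom (Units.map _ _) ∈ infIdentityComponent K
      rw [pow_mul, map_pow, map_pow]
      exact sq_mem_infIdentityComponent _
    · exact Units.ext (OKp.toKp_ofInt _).symm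
  · rw [← map_pow] at hb
    have hmem := (QuotientGroup.eq_one_iff _).1 hb
    have hx := (P : Subgroup (OKp p K)ˣ).pow_mem hmem (a * 2)
    rwa [← pow_mul, ← map_pow, show b * (a * 2) = a * b * 2 by ring] at hx

end UnitsInLevel

/-! ### Topological generators of `1 + p^s ℤ_p` -/

namespace PadicInt

open Filter

variable {p : ℕ} [Fact p.Prime]

theorem isUnit_add_p_mul {w : ℤ_[p]} (hw : IsUnit w) (z : ℤ_[p]) : IsUnit (w + p * z) := by
  by_contra h
  have hp : (p : ℤ_[p]) * -z ∈ nonunits ℤ_[p] := fun h => p_nonunit (isUnit_of_mul_isUnit_left h)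
  have := IsLocalRing.nonunits_add h hp
  rw [mul_neg, add_neg_cancel_right] at this
  exact this hw

/-- Raising to the power `p` moves `1 + p^t ℤ_pˣ` to `1 + p^{t+1} ℤ_pˣ`, if `t ≥ 2`. -/
theorem exists_one_add_pow_mul_pow {t : ℕ} (ht : 2 ≤ t) {w : ℤ_[p]} (hw : IsUnit w) :
    ∃ w' : ℤ_[p], IsUnit w' ∧ (1 + (p : ℤ_[p]) ^ t * w) ^ p = 1 + (p : ℤ_[p]) ^ (t + 1) * w' := by
  obtain ⟨k, hk⟩ := Polynomial.powAddExpansion 1 ((p : ℤ_[p]) ^ t * w) p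
  obtain ⟨s, rfl⟩ := Nat.exists_eq_add_of_le ht
  refine ⟨w + p * (p ^ s * w ^ 2 * k), isUnit_add_p_mul hw _, ?_⟩
  rw [hk]
  ring

theorem exists_one_add_pow_mul_pow_pow {s : ℕ} (hs : 2 ≤ s) {w : ℤ_[p]} (hw : IsUnit w) (n : ℕ) :
    ∃ w' : ℤ_[p], IsUnit w' ∧
      (1 + (p : ℤ_[p]) ^ s * w) ^ p ^ n = 1 + (p : ℤ_[p]) ^ (s + n) * w' := by
  induction n with
  | zero => exact ⟨w, hw, by simp⟩
  | succ n ih =>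
    obtain ⟨w', hw', h⟩ := ih
    obtain ⟨w'', hw'', h'⟩ := exists_one_add_pow_mul_pow (by omega : 2 ≤ s + n) hw'
    exact ⟨w'', hw'', by rw [pow_succ, pow_mul, h, h', add_assoc]⟩

/-- Successive approximation of elements of `1 + p^s ℤ_p` by powers of `1 + p^s w`. -/
theorem exists_one_add_pow_mul_pow_eq {s : ℕ} (hs : 2 ≤ s) {w : ℤ_[p]} (hw : IsUnit w)
    (y : ℤ_[p]) (n : ℕ) :
    ∃ (k : ℕ) (z : ℤ_[p]), (1 + (p : ℤ_[p]) ^ s * w) ^ k =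
      1 + (p : ℤ_[p]) ^ s * y + (p : ℤ_[p]) ^ (s + n) * z := by
  induction n with
  | zero => exact ⟨0, -y, by ring⟩
  | succ n ih =>
    obtain ⟨k, z, hk⟩ := ih
    obtain ⟨w', hw', h⟩ := exists_one_add_pow_mul_pow_pow hs hw n
    have hb : IsUnit (1 + (p : ℤ_[p]) ^ s * w) := by
      obtain ⟨t, rfl⟩ := Nat.exists_eq_add_of_le hs
      have := isUnit_add_p_mul isUnit_one ((p : ℤ_[p]) ^ (t + 1) * w)
      rwa [← mul_assoc, ← pow_succ', show t + 1 + 1 = 2 + t by omega] at this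
    obtain ⟨v, hv⟩ := (hb.pow k).mul hw'
    -- `j` solves `z + b ^ k * w' * j ≡ 0` modulo `p`, where `b = 1 + p ^ s * w`
    obtain ⟨j, -, hj⟩ := exists_mem_range (-((v⁻¹ : ℤ_[p]ˣ) : ℤ_[p]) * z)
    rw [maximalIdeal_eq_span_p, Ideal.mem_span_singleton] at hj
    obtain ⟨e, he⟩ := hj
    obtain ⟨l, hl⟩ := Polynomial.powAddExpansion 1 ((p : ℤ_[p]) ^ (s + n) * w') j
    obtain ⟨t, rfl⟩ := Nat.exists_eq_add_of_le hs
    refine ⟨k + p ^ n * j, -(v : ℤ_[p]) * e + (1 + (p : ℤ_[p]) ^ (2 + t) * w) ^ k *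
      (l * w' ^ 2 * p ^ (1 + t + n)), ?_⟩
    have hz : z + (v : ℤ_[p]) * j = -(v : ℤ_[p]) * (p * e) := by
      rw [← he]
      linear_combination -z * v.mul_inv
    rw [pow_add, pow_mul, h, hl, one_pow, one_pow, mul_one]
    generalize hB : (1 + (p : ℤ_[p]) ^ (2 + t) * w) ^ k = B at *
    have hz' : z + B * w' * j = -(v : ℤ_[p]) * (p * e) := by rw [← hv]; exact hz
    linear_combination hk + (p : ℤ_[p]) ^ (2 + t + n) * hz'

/-- A nontrivial element of `1 + p² ℤ_p` topologically generates an open subgroup of `ℤ_pˣ`. -/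
theorem closure_range_pow_mem_nhds {b : ℤ_[p]ˣ} (hb : ∃ y : ℤ_[p], (b : ℤ_[p]) = 1 + p ^ 2 * y)
    (hb1 : b ≠ 1) : closure (Set.range fun n : ℕ => b ^ n) ∈ 𝓝 (1 : ℤ_[p]ˣ) := by
  obtain ⟨y, hy⟩ := hb
  have hy0 : y ≠ 0 := fun h => hb1 (Units.ext (by rw [hy, h]; simp))
  obtain ⟨s, hs, w, hw, hbw⟩ : ∃ s, 2 ≤ s ∧ ∃ w : ℤ_[p], IsUnit w ∧
      (b : ℤ_[p]) = 1 + (p : ℤ_[p]) ^ s * w :=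
    ⟨2 + y.valuation, by omega, unitCoeff hy0, (unitCoeff hy0).isUnit, by
      rw [hy, pow_add, mul_assoc, mul_comm (_ ^ y.valuation), ← unitCoeff_spec]⟩
  have hball : ∀ {x z : ℤ_[p]} {n : ℕ}, x = (p : ℤ_[p]) ^ n * z → ‖x‖ ≤ (p : ℝ) ^ (-n : ℤ) := by
    rintro x z n rfl
    exact (norm_le_pow_iff_mem_span_pow _ _).2 (Ideal.mem_span_singleton.2 (Dvd.intro _ rfl))
  have hnhds : {x : ℤ_[p] | ‖x - 1‖ ≤ (p : ℝ) ^ (-s : ℤ)} ∈ 𝓝 1 := by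
    have h := Metric.closedBall_mem_nhds (1 : ℤ_[p]) (ε := (p : ℝ) ^ (-s : ℤ))
      (zpow_pos (by exact_mod_cast (Fact.out : p.Prime).pos) _)
    convert h using 2 with x
    exact Set.ext fun x => by simp [dist_eq_norm]
  refine mem_of_superset (Units.continuous_val.continuousAt.preimage_mem_nhds hnhds) fun x hx => ?_
  obtain ⟨y', hy'⟩ := Ideal.mem_span_singleton.1 ((norm_le_pow_iff_mem_span_pow _ _).1 hx)
  rw [Units.isOpenEmbedding_val.isInducing.closure_eq_preimage_closure_image]
  refine Metric.mem_closure_iff.2 fun ε hε => ?_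
  obtain ⟨n, hn⟩ := exists_pow_neg_lt p hε
  obtain ⟨k, z, hk⟩ := exists_one_add_pow_mul_pow_eq hs hw y' n
  refine ⟨_, ⟨b ^ k, ⟨k, rfl⟩, rfl⟩, lt_of_le_of_lt ?_ hn⟩
  rw [dist_comm, dist_eq_norm, Units.val_pow_eq_pow_val, hbw, hk]
  refine hball (z := p ^ s * z) ?_
  linear_combination -hy'

end PadicInt

/-! ### Parallel weights and their translates by weights of finite order -/

section Parallel

theorem ContinuousMonoidHom.zpow_apply {A B : Type*} [Monoid A] [TopologicalSpace A] [CommGroup B]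
    [TopologicalSpace B] [IsTopologicalGroup B] (f : ContinuousMonoidHom A B) (n : ℤ) (x : A) :
    (f ^ n) x = f x ^ n :=
  map_zpow ({ toFun := fun f => f x, map_one' := rfl, map_mul' := fun _ _ => rfl } :
    ContinuousMonoidHom A B →* B) f n

open Filter

variable (p : ℕ) [Fact p.Prime] (K : Type*) [Field K] [NumberField K]

theorem normOntoImage_surjective : Function.Surjective (normOntoImage p K) :=
  (unitsNorm p K).toMonoidHom.rangeRestrict_surjective

instance : CompactSpace (NormImage p K) :=
  (normOntoImage_surjective p K).compactSpace (normOntoImage p K).continuous_toFun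

instance : Nontrivial (OKp p K) :=
  (OKp.embed p (Classical.arbitrary (K →+* PadicAlgCl p))).domain_nontrivial

/-- The rational integer `1 + p²`, as an element of `ℤ_pˣ`. -/
def onePlusSq : ℤ_[p]ˣ :=
  (show IsUnit (1 + (p : ℤ_[p]) * p) from PadicInt.isUnit_add_p_mul isUnit_one _).unit

theorem val_onePlusSq : (onePlusSq p : ℤ_[p]) = 1 + (p : ℤ_[p]) * p := rfl

/-- A power of `1 + p²` in `𝒪_{K,p}ˣ`. -/
def onePlusSqPow (m : ℕ) : (OKp p K)ˣ :=
  Units.map (algebraMap ℤ_[p] (OKp p K)).toMonoidHom (onePlusSq p) ^ m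

theorem unitsNorm_onePlusSqPow (m : ℕ) :
    unitsNorm p K (onePlusSqPow p K m) =
      onePlusSq p ^ (Module.finrank ℤ_[p] (OKp p K) * m) := by
  rw [onePlusSqPow, map_pow, pow_mul]
  congr 1
  refine Units.ext ?_
  rw [Units.val_pow_eq_pow_val]
  exact Algebra.norm_algebraMap _

theorem tendsto_onePlusSqPow_pow (m : ℕ) :
    Tendsto (fun n : ℕ => onePlusSqPow p K m ^ p ^ n) atTop (𝓝 1) := by
  rw [tendsto_def]
  intro V hV
  obtain ⟨r, hr⟩ := OKp.exists_onePlus_subset hV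
  filter_upwards [eventually_ge_atTop r] with n hn
  refine hr (OKp.onePlus_anti hn ?_)
  have h : ∃ y : ℤ_[p], ((onePlusSq p : ℤ_[p])) ^ p ^ n = 1 + (p : ℤ_[p]) ^ n * y := by
    obtain ⟨w, -, hw⟩ :=
      PadicInt.exists_one_add_pow_mul_pow_pow (p := p) le_rfl isUnit_one n
    refine ⟨p ^ 2 * w, ?_⟩
    rw [val_onePlusSq, ← mul_assoc, ← pow_add, add_comm n 2, ← hw]
    ring
  obtain ⟨y, hy⟩ := h
  have hmem : Units.map (algebraMap ℤ_[p] (OKp p K)).toMonoidHom (onePlusSq p) ^ p ^ n ∈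
      OKp.onePlusSubgroup p K n := by
    refine ⟨algebraMap ℤ_[p] (OKp p K) y, ?_⟩
    have := congrArg (algebraMap ℤ_[p] (OKp p K)) hy
    rwa [map_pow, map_add, map_mul, map_pow, map_one, map_natCast] at this
  have := (OKp.onePlusSubgroup p K n : Subgroup (OKp p K)ˣ).pow_mem hmem m
  rwa [← pow_mul, mul_comm, pow_mul] at this

theorem closure_normOntoImage_mem_nhds {m : ℕ} (hm : 0 < m) :
    closure (Set.range fun n : ℕ => normOntoImage p K (onePlusSqPow p K m) ^ n) ∈
      𝓝 (1 : NormImage p K) := by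
  have hp := (Fact.out : p.Prime).pos
  set d := Module.finrank ℤ_[p] (OKp p K) * m
  have hd : d ≠ 0 := (Nat.mul_pos Module.finrank_pos hm).ne'
  have h : closure (Set.range fun n : ℕ => (onePlusSq p ^ d) ^ n) ∈ 𝓝 (1 : ℤ_[p]ˣ) := by
    refine PadicInt.closure_range_pow_mem_nhds ?_ fun h => ?_
    · have : (p : ℤ_[p]) ^ 2 ∣ (onePlusSq p : ℤ_[p]) ^ d - 1 ^ d :=
        (Dvd.intro 1 (by rw [val_onePlusSq]; ring)).trans (sub_dvd_pow_sub_pow _ _ d)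
      obtain ⟨y, hy⟩ := this
      refine ⟨y, ?_⟩
      rw [Units.val_pow_eq_pow_val]
      linear_combination hy
    · have h' : ((1 + p * p : ℕ) : ℤ_[p]) ^ d = ((1 : ℕ) : ℤ_[p]) := by
        have := congrArg Units.val h
        rw [Units.val_pow_eq_pow_val, val_onePlusSq, Units.val_one] at this
        exact_mod_cast this
      rw [← Nat.cast_pow, Nat.cast_inj] at h'
      have := Nat.one_lt_pow hd (show 1 < 1 + p * p by simp [hp])
      omega
  rw [Topology.IsInducing.subtypeVal.closure_eq_preimage_closure_image]
  refine mem_of_superset (continuous_subtype_val.continuousAt.preimage_mem_nhds h) ?_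
  refine Set.preimage_mono (closure_mono ?_)
  rintro _ ⟨n, rfl⟩
  refine ⟨_, ⟨n, rfl⟩, ?_⟩
  change unitsNorm p K (onePlusSqPow p K m) ^ n = _
  rw [unitsNorm_onePlusSqPow]

/-- The inclusion `N_{K/ℚ}(𝒪_{K,p}ˣ) → ℚ̄_pˣ`. -/
def normImageIncl : ContinuousMonoidHom (NormImage p K) (PadicAlgCl p)ˣ where
  toMonoidHom := (Units.map (padicIntToAlgCl p).toMonoidHom).comp (NormImage p K).subtype
  continuous_toFun := (Continuous.units_map (padicIntToAlgCl p).toMonoidHom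
    OKp.continuous_padicIntToAlgCl).comp continuous_subtype_val

variable {p K}

theorem normWeight_apply (x : (OKp p K)ˣ) :
    (normWeight p K).1 x = normImageIncl p K (normOntoImage p K x) := rfl

/-- If `f` is a quotient of `𝒪_{K,p}ˣ` through which the norm factors, and a power of `1 + p²`
topologically generates an open subgroup of the target, then the closed formal subscheme of `𝒲`
defined by `f` is flat of dimension `1`. -/
theorem isFlatOfDim_one_of_factor {Q : Type*} [CommGroup Q] [TopologicalSpace Q]
    [IsTopologicalGroup Q] [CompactSpace Q] (f : ContinuousMonoidHom (OKp p K)ˣ Q)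
    (r : ContinuousMonoidHom Q (NormImage p K)) (hr : ∀ x, r (f x) = normOntoImage p K x)
    {m : ℕ} (hm : 0 < m)
    (hf : closure (Set.range fun n : ℕ => f (onePlusSqPow p K m) ^ n) ∈ 𝓝 (1 : Q)) :
    ClosedFormalSubscheme.IsFlatOfDim
      (RingHom.ker (IwasawaAlgebra.map p f) : ClosedFormalSubscheme p (OKp p K)ˣ) 1 := by
  set g := onePlusSqPow p K m
  have hcl : ((Subgroup.zpowers (f g)).topologicalClosure : Set Q) =
      closure (Set.range fun n : ℕ => f g ^ n) := by
    rw [← closure_range_zpow_eq_pow]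
    rfl
  refine IwasawaAlgebra.isFlatOfDim_one_ker_map f (tendsto_onePlusSqPow_pow p K m)
    ⟨(Subgroup.zpowers (f g)).topologicalClosure, Subgroup.isOpen_of_mem_nhds _ (hcl ▸ hf)⟩
    hcl.le (c := (1 + p * p) ^ (Module.finrank ℤ_[p] (OKp p K) * m)) ?_ fun k => ?_
  · have hp := (Fact.out : p.Prime).pos
    exact Nat.one_lt_pow (Nat.mul_pos Module.finrank_pos hm).ne' (show 1 < 1 + p * p by simp [hp])
  · refine ⟨(normWeight p K).1 ^ k, IwasawaAlgebra.hasPoint_ker_map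
      ((normImageIncl p K ^ k).comp r) f (E := ⊥) (fun q => ?_) (fun x => ?_), ?_⟩
    · change (((normImageIncl p K ^ k) (r q) : (PadicAlgCl p)ˣ) : PadicAlgCl p) ∈ _
      rw [ContinuousMonoidHom.pow_apply, Units.val_pow_eq_pow_val]
      exact pow_mem (IntermediateField.algebraMap_mem _ _) k
    · change ((normWeight p K).1 ^ k) x = (normImageIncl p K ^ k) (r (f x))
      rw [ContinuousMonoidHom.pow_apply, ContinuousMonoidHom.pow_apply, hr, normWeight_apply]
    · rw [ContinuousMonoidHom.pow_apply, Units.val_pow_eq_pow_val]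
      congr 1
      change padicIntToAlgCl p (unitsNorm p K g : ℤ_[p]ˣ) = _
      rw [unitsNorm_onePlusSqPow, Units.val_pow_eq_pow_val, val_onePlusSq]
      simp

variable (p K) in
theorem parallelSubscheme_isFlatOfDim_one : (parallelSubscheme p K).IsFlatOfDim 1 :=
  isFlatOfDim_one_of_factor (normOntoImage p K) (ContinuousMonoidHom.id _) (fun _ => rfl)
    one_pos (closure_normOntoImage_mem_nhds p K one_pos)

/-- A point of `𝒲₀` is trivial on the kernel of the norm, because `[g] - 1` is in the ideal of `𝒲₀`
for `g` in that kernel.  The induced character is continuous as the norm is a quotient map. -/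
theorem isParallel_of_mem_weightPoints {κ : PadicWeight p K}
    (hκ : κ ∈ weightPoints p K (parallelSubscheme p K)) : IsParallel κ := by
  obtain ⟨φ, -, hφ, hφ0⟩ := hκ
  have hker : (normOntoImage p K).toMonoidHom.ker ≤ κ.1.toMonoidHom.ker := by
    intro g hg
    have h := hφ0 (IwasawaAlgebra.of p g - 1) <| by
      change IwasawaAlgebra.map p (normOntoImage p K) _ = 0
      rw [map_sub, IwasawaAlgebra.map_of, map_one, show normOntoImage p K g = 1 from hg,
        IwasawaAlgebra.of_one, sub_self]
    rw [map_sub, map_one, hφ, sub_eq_zero] at h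
    exact Units.ext h
  have hq : IsQuotientMap (normOntoImage p K) :=
    (normOntoImage p K).continuous_toFun.isClosedMap.isQuotientMap
      (normOntoImage p K).continuous_toFun (normOntoImage_surjective p K)
  have hlift : ∀ x, (normOntoImage p K).toMonoidHom.liftOfSurjective
      (normOntoImage_surjective p K) ⟨κ.1.toMonoidHom, hker⟩ (normOntoImage p K x) = κ.1 x :=
    fun x => MonoidHom.liftOfRightInverse_comp_apply _ _ _ ⟨κ.1.toMonoidHom, hker⟩ x
  refine ⟨⟨(normOntoImage p K).toMonoidHom.liftOfSurjective (normOntoImage_surjective p K)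
    ⟨κ.1.toMonoidHom, hker⟩, hq.continuous_iff.2 ?_⟩, fun x => (hlift x).symm⟩
  exact (continuous_congr hlift).2 κ.1.continuous_toFun

theorem IsParallel.mem_weightPoints {κ : PadicWeight p K} (hκ : IsParallel κ) :
    κ ∈ weightPoints p K (parallelSubscheme p K) := by
  obtain ⟨χ, hχ⟩ := hκ
  obtain ⟨E, hE, hκE⟩ := κ.2
  refine IwasawaAlgebra.hasPoint_ker_map χ (normOntoImage p K) (E := E) (fun q => ?_) hχ
  obtain ⟨x, rfl⟩ := normOntoImage_surjective p K q
  rw [← hχ]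
  exact hκE x

variable (p K) in
theorem weightPoints_parallelSubscheme :
    weightPoints p K (parallelSubscheme p K) = {χ | IsParallel χ} :=
  Set.ext fun _ => ⟨isParallel_of_mem_weightPoints, IsParallel.mem_weightPoints⟩

theorem isParallel_normWeight_zpow (k : ℤ) : IsParallel (normWeight p K ^ k) :=
  ⟨normImageIncl p K ^ k, fun x => by
    rw [Subgroup.coe_zpow, ContinuousMonoidHom.zpow_apply, ContinuousMonoidHom.zpow_apply,
      normWeight_apply]⟩

/-! ### Weights that are trivial on `1 + p^N 𝒪_{K,p}` -/

variable (p K) (N : ℕ)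

/-- The finite group `𝒪_{K,p}ˣ / (1 + p^N 𝒪_{K,p})`. -/
abbrev ResidueUnits : Type _ := (OKp p K)ˣ ⧸ (OKp.onePlusSubgroup p K N : Subgroup (OKp p K)ˣ)

instance : Finite (ResidueUnits p K N) :=
  Subgroup.quotient_finite_of_isOpen _ (OKp.onePlusSubgroup p K N).isOpen

instance : DiscreteTopology (ResidueUnits p K N) :=
  QuotientGroup.discreteTopology (OKp.onePlusSubgroup p K N).isOpen

/-- The weights that are trivial on `1 + p^N 𝒪_{K,p}`. -/
def weightsTrivialOn : Set (PadicWeight p K) := {ε | ∀ x ∈ onePlus p K N, ε.1 x = 1}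

variable {p K N}

theorem apply_pow_card_of_mem_weightsTrivialOn {ε : PadicWeight p K}
    (hε : ε ∈ weightsTrivialOn p K N) (x : (OKp p K)ˣ) :
    ε.1 x ^ Nat.card (ResidueUnits p K N) = 1 := by
  rw [← map_pow]
  refine hε _ (OKp.mem_onePlusSubgroup.1 ((QuotientGroup.eq_one_iff
    (N := (OKp.onePlusSubgroup p K N : Subgroup (OKp p K)ˣ)) _).1 ?_))
  exact pow_card_eq_one' (x := (x : ResidueUnits p K N))

theorem isOfFinOrder_of_mem_weightsTrivialOn {ε : PadicWeight p K}
    (hε : ε ∈ weightsTrivialOn p K N) : IsOfFinOrder ε :=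
  isOfFinOrder_iff_pow_eq_one.2 ⟨Nat.card (ResidueUnits p K N), Nat.card_pos, Subtype.ext <|
    ContinuousMonoidHom.ext fun x => (ContinuousMonoidHom.pow_apply _ _ _).trans <|
      apply_pow_card_of_mem_weightsTrivialOn hε x⟩

theorem apply_eq_of_mem_weightsTrivialOn {ε : PadicWeight p K} (hε : ε ∈ weightsTrivialOn p K N)
    {x y : (OKp p K)ˣ} (h : (x : ResidueUnits p K N) = y) : ε.1 x = ε.1 y := by
  have := hε _ (OKp.mem_onePlusSubgroup.1 (QuotientGroup.eq.1 h))
  rwa [map_mul, map_inv, inv_mul_eq_one] at this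

variable (p K N) in
theorem finite_weightsTrivialOn : (weightsTrivialOn p K N).Finite := by
  have : NeZero (Nat.card (ResidueUnits p K N)) := ⟨Nat.card_pos.ne'⟩
  let F : weightsTrivialOn p K N →
      ResidueUnits p K N → rootsOfUnity (Nat.card (ResidueUnits p K N)) (PadicAlgCl p) :=
    fun ε q => ⟨ε.1.1 q.out, apply_pow_card_of_mem_weightsTrivialOn ε.2 _⟩
  refine Finite.of_injective F fun ε ε' h => ?_
  refine Subtype.ext (Subtype.ext (ContinuousMonoidHom.ext fun x => ?_))
  have hx : ((x : ResidueUnits p K N).out : ResidueUnits p K N) = x := QuotientGroup.out_eq' _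
  rw [← apply_eq_of_mem_weightsTrivialOn ε.2 hx, ← apply_eq_of_mem_weightsTrivialOn ε'.2 hx]
  exact congrArg Subtype.val (congrFun h x)

variable (p K N) in
/-- The norm together with the reduction modulo `p^N`. -/
def normProdReduction :
    ContinuousMonoidHom (OKp p K)ˣ (NormImage p K × ResidueUnits p K N) :=
  (normOntoImage p K).prod ⟨QuotientGroup.mk' _, QuotientGroup.continuous_mk⟩

variable (p K N) in
theorem ker_normProdReduction_isFlatOfDim_one : ClosedFormalSubscheme.IsFlatOfDim
    (RingHom.ker (IwasawaAlgebra.map p (H := NormImage p K × ResidueUnits p K N)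
      (normProdReduction p K N)) :
      ClosedFormalSubscheme p (OKp p K)ˣ) 1 := by
  -- the order of the group makes the second component of the generator trivial
  set m := Nat.card (ResidueUnits p K N)
  refine isFlatOfDim_one_of_factor _ (ContinuousMonoidHom.fst _ _) (fun _ => rfl)
    (m := m) Nat.card_pos ?_
  have hsnd : ((onePlusSqPow p K m : (OKp p K)ˣ) : ResidueUnits p K N) = 1 :=
    pow_card_eq_one' (G := ResidueUnits p K N) (x := (QuotientGroup.mk
      (Units.map (algebraMap ℤ_[p] (OKp p K)).toMonoidHom (onePlusSq p))))
  have hrange : (Set.range fun n : ℕ => normProdReduction p K N (onePlusSqPow p K m) ^ n) =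
      (Set.range fun n : ℕ => normOntoImage p K (onePlusSqPow p K m) ^ n) ×ˢ {1} := by
    ext ⟨a, b⟩
    constructor
    · rintro ⟨n, hn⟩
      obtain ⟨rfl, rfl⟩ := Prod.ext_iff.1 hn
      refine ⟨⟨n, rfl⟩, ?_⟩
      change ((onePlusSqPow p K m : (OKp p K)ˣ) : ResidueUnits p K N) ^ n = 1
      rw [hsnd, one_pow]
    · rintro ⟨⟨n, rfl⟩, rfl⟩
      refine ⟨n, Prod.ext rfl ?_⟩
      change ((onePlusSqPow p K m : (OKp p K)ˣ) : ResidueUnits p K N) ^ n = 1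
      rw [hsnd, one_pow]
  rw [hrange, closure_prod_eq, Prod.one_eq_mk]
  exact prod_mem_nhds (closure_normOntoImage_mem_nhds p K Nat.card_pos)
    (mem_nhds_discrete.2 (subset_closure rfl))

theorem hasPoint_ker_normProdReduction {ε κ : PadicWeight p K} (hε : ε ∈ weightsTrivialOn p K N)
    (hκ : IsParallel κ) :
    ε * κ ∈ weightPoints p K (RingHom.ker (IwasawaAlgebra.map p
      (H := NormImage p K × ResidueUnits p K N) (normProdReduction p K N))) := by
  obtain ⟨χ, hχ⟩ := hκ
  let ε' : ContinuousMonoidHom (ResidueUnits p K N) (PadicAlgCl p)ˣ :=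
    ⟨QuotientGroup.lift _ ε.1.toMonoidHom hε, continuous_of_discreteTopology⟩
  obtain ⟨E, hE, hεE⟩ := ε.2
  obtain ⟨F, hF, hκF⟩ := κ.2
  have : FiniteDimensional ℚ_[p] (E ⊔ F : IntermediateField ℚ_[p] (PadicAlgCl p)) :=
    IntermediateField.finiteDimensional_sup E F
  refine IwasawaAlgebra.hasPoint_ker_map
    ((ε'.comp (ContinuousMonoidHom.snd _ _)) * (χ.comp (ContinuousMonoidHom.fst _ _))) _
    (E := E ⊔ F) ?_ fun x => ?_
  · rintro ⟨a, b⟩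
    obtain ⟨x, rfl⟩ := normOntoImage_surjective p K a
    obtain ⟨y, rfl⟩ := QuotientGroup.mk_surjective b
    change ((ε.1 y * χ (normOntoImage p K x) : (PadicAlgCl p)ˣ) : PadicAlgCl p) ∈ _
    rw [← hχ, Units.val_mul]
    exact mul_mem (le_sup_left (a := E) (b := F) (hεE y)) (le_sup_right (a := E) (b := F) (hκF x))
  · change ε.1 x * κ.1 x = _
    rw [hχ]
    rfl

end Parallel

/-! ### Locally algebraic weights of bounded conductor -/

section LocallyAlgebraic

open Filter

variable {p : ℕ} [Fact p.Prime] {K : Type*} [Field K] [NumberField K]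

theorem IsLocallyAlgebraic.isAlgebraicOn_onePlus {κ : PadicWeight p K} (hκ : IsLocallyAlgebraic κ)
    {N : ℕ} (hN : conductorExponent κ ≤ N) : IsAlgebraicOn κ (onePlus p K N) := by
  have hne : {r : ℕ | IsAlgebraicOn κ (onePlus p K r)}.Nonempty := by
    obtain ⟨V, hV, n, hn⟩ := hκ
    obtain ⟨r, hr⟩ := OKp.exists_onePlus_subset hV
    exact ⟨r, n, fun x hx => hn x (hr hx)⟩
  obtain ⟨n, hn⟩ := Nat.sInf_mem hne
  exact ⟨n, fun x hx => hn x (OKp.onePlus_anti hN hx)⟩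

/-- The exponents of a locally algebraic weight of level `U` give a multiplicative relation between
the conjugates of every unit, so they are all equal. -/
theorem exponents_eq (hK : ∀ F : IntermediateField ℚ K, ¬ IsCMField F)
    {U : Subgroup (AdelesAway p K)ˣ} (hU : IsOpen (U : Set (AdelesAway p K)ˣ))
    {κ : PadicWeight p K} (hκ : κ ∈ weightsOfLevel U) {N : ℕ} {n : (K →+* PadicAlgCl p) → ℤ}
    (hn : ∀ x ∈ onePlus p K N, (κ.1 x : PadicAlgCl p) = ∏ σ, (OKp.embed p σ x) ^ n σ)
    (σ σ' : K →+* PadicAlgCl p) : n σ = n σ' := by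
  refine NumberField.eq_of_forall_units_prod_pow_eq_one hK n (fun u => ?_) σ σ'
  obtain ⟨m, hm, hmU, hmN⟩ := exists_pow_mem_gammaLevel hU (OKp.onePlusSubgroup p K N) u
  refine ⟨m, hm, ?_⟩
  have h := hn _ hmN
  rw [hκ _ (Subgroup.le_topologicalClosure _ hmU), Units.val_one] at h
  rw [h]
  exact Finset.prod_congr rfl fun σ _ => congrArg (· ^ n σ) (OKp.embed_ofInt σ _).symm

theorem exists_mul_normWeight_zpow (hK : ∀ F : IntermediateField ℚ K, ¬ IsCMField F)
    {U : Subgroup (AdelesAway p K)ˣ} (hU : IsOpen (U : Set (AdelesAway p K)ˣ))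
    {κ : PadicWeight p K} (hκ : κ ∈ weightsOfLevel U) (hla : IsLocallyAlgebraic κ)
    {N : ℕ} (hN : conductorExponent κ ≤ N) :
    ∃ ε ∈ weightsTrivialOn p K N, ∃ k : ℤ, κ = ε * normWeight p K ^ k := by
  obtain ⟨n, hn⟩ := hla.isAlgebraicOn_onePlus hN
  let σ₀ : K →+* PadicAlgCl p := Classical.arbitrary _
  refine ⟨κ * (normWeight p K ^ n σ₀)⁻¹, fun x hx => ?_, n σ₀, (inv_mul_cancel_right _ _).symm⟩
  change κ.1 x * ((normWeight p K ^ n σ₀).1 x)⁻¹ = 1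
  rw [mul_inv_eq_one, Subgroup.coe_zpow, ContinuousMonoidHom.zpow_apply]
  refine Units.ext ?_
  rw [hn x hx, Units.val_zpow_eq_zpow_val]
  change _ = padicIntToAlgCl p (Algebra.norm ℤ_[p] (x : OKp p K)) ^ n σ₀
  rw [OKp.padicIntToAlgCl_norm, ← Finset.prod_zpow]
  exact Finset.prod_congr rfl fun σ _ => by rw [exponents_eq hK hU hκ hn σ σ₀]

end LocallyAlgebraic

end

theorem mainTheorem3 (p : ℕ) [Fact p.Prime] (K : Type*) [Field K] [NumberField K]
    (hK : ∀ F : IntermediateField ℚ K, ¬ IsCMField F)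
    (U : Subgroup (AdelesAway p K)ˣ)
    (hUo : IsOpen (U : Set (AdelesAway p K)ˣ)) (hUc : IsCompact (U : Set (AdelesAway p K)ˣ))
    (N : ℕ) :
    ((parallelSubscheme p K).IsFlatOfDim 1 ∧
      weightPoints p K (parallelSubscheme p K) = {χ | IsParallel χ}) ∧
    ∃ S : Set (PadicWeight p K), S.Finite ∧ (∀ ε ∈ S, IsOfFinOrder ε) ∧
      (∀ κ ∈ weightsOfLevel U, IsLocallyAlgebraic κ → conductorExponent κ ≤ N →
        ∃ ε ∈ S, ∃ k : ℤ, κ = ε * normWeight p K ^ k) ∧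
      {κ | κ ∈ weightsOfLevel U ∧ IsLocallyAlgebraic κ ∧ conductorExponent κ ≤ N} ⊆
        ⋃ ε ∈ S, (ε * ·) '' weightPoints p K (parallelSubscheme p K) ∧
      ∃ Z : ClosedFormalSubscheme p (OKp p K)ˣ, Z.IsFlatOfDim 1 ∧
        (⋃ ε ∈ S, (ε * ·) '' weightPoints p K (parallelSubscheme p K)) ⊆ weightPoints p K Z ∧
        ∀ κ ∈ weightsOfLevel U, IsLocallyAlgebraic κ → conductorExponent κ ≤ N →
          κ ∈ weightPoints p K Z := by
  refine ⟨⟨parallelSubscheme_isFlatOfDim_one p K, weightPoints_parallelSubscheme p K⟩,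
    weightsTrivialOn p K N, finite_weightsTrivialOn p K N,
    fun ε hε => isOfFinOrder_of_mem_weightsTrivialOn hε,
    fun κ hκ hla hN => exists_mul_normWeight_zpow hK hUo hκ hla hN, ?_,
    RingHom.ker (IwasawaAlgebra.map p (H := NormImage p K × ResidueUnits p K N)
      (normProdReduction p K N)),
    ker_normProdReduction_isFlatOfDim_one p K N, ?_, fun κ hκ hla hN => ?_⟩
  · rintro κ ⟨hκ, hla, hN⟩
    obtain ⟨ε, hε, k, rfl⟩ := exists_mul_normWeight_zpow hK hUo hκ hla hN
    exact Set.mem_biUnion hε ⟨_, (isParallel_normWeight_zpow k).mem_weightPoints, rfl⟩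
  · refine Set.iUnion₂_subset fun ε hε => ?_
    rintro _ ⟨κ, hκ, rfl⟩
    exact hasPoint_ker_normProdReduction hε (isParallel_of_mem_weightPoints hκ)
  · obtain ⟨ε, hε, k, rfl⟩ := exists_mul_normWeight_zpow hK hUo hκ hla hN
    exact hasPoint_ker_normProdReduction hε (isParallel_normWeight_zpow k)
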